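/- Conventions. For $f$ on $\mathbb R^n$ let $\hat f(\xi)=\int e^{-ix\cdot\xi}f(x)\,dx$. For real $s>-1$ and $f\in L^1(\mathbb R^n)$ with compact support, let $S^sf(x)=(2\pi)^{-n}\int_{|\xi|<1}(1-|\xi|^2)^s\hat f(\xi)e^{ix\cdot\xi}\,d\xi$ and $\tilde S^sf=\Gamma(s+1)^{-1}S^sf$; for $z\in\mathbb C$, $\tilde S^zf(x)$ is the value at $z$ of the entire function that continues $s\mapsto\tilde S^sf(x)$ analytically. The function $(z+2)\Gamma(z+1)$ is given its limit $-1$ at its removable singularity $z=-2$. Proposition. Let $n\ge 1$, $\frac12<\beta<\frac32$ and $\beta\le\frac{n+1}4$, and put $p=\frac{2n+2}{n+1+4\beta}$ and $q=\frac{2n+2}{n+1-4\beta}$ (with $q=\infty$ if $\beta=\frac{n+1}4$). Then there is a constant $C=C(n,\beta)$ such that for every $\mu\in\mathbb R$ the operator $\tilde S^{-2\beta+i\mu}$ is well defined by this analytic continuation on the compactly supported functions in $L^p(\mathbb R^n)$, extends to a linear operator from $L^p(\mathbb R^n)$ to $L^q(\mathbb R^n)$, and this extension satisfies $$\big\|(2-2\beta+i\mu)\,\Gamma(1-2\beta+i\mu)\,\tilde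 S^{-2\beta+i\mu}f\big\|_{L^q(\mathbb R^n)}\le C\,(1+|\mu|)\,\|f\|_{L^p(\mathbb R^n)}\qquad\text{for all } f\in L^p(\mathbb R^n).$$ -/

import Mathlib

open MeasureTheory Filter Topology
open scoped ENNReal FourierTransform

noncomputable section

/-- The symbol `(1 - |ξ|²)₊ ^ s`, equal to `(1 - |ξ|²) ^ s` in the open unit ball and `0` outside
(also for `s = 0`, where it is the characteristic function of the ball). -/
def bochnerRieszSymbol {n : ℕ} (s : ℝ) (ξ : EuclideanSpace ℝ (Fin n)) : ℝ :=
  (Metric.ball (0 : EuclideanSpace ℝ (Fin n)) 1).indicator (fun ζ => (1 - ‖ζ‖ ^ 2) ^ s) ξ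

/-- The Bochner–Riesz operator `S ^ s`, for real `s > -1`: the Fourier multiplier with symbol
`(1 - |ξ|²)₊ ^ s`, where `ξ` is the angular frequency, dual to `x` through `exp (i x·ξ)`. As
Mathlib's transform `𝓕` uses `exp (-2πi x·η)`, the angular frequency is `ξ = 2πη`. -/
def bochnerRiesz {n : ℕ} (s : ℝ) (f : EuclideanSpace ℝ (Fin n) → ℂ) :
    EuclideanSpace ℝ (Fin n) → ℂ :=
  𝓕⁻ (fun η : EuclideanSpace ℝ (Fin n) =>
    (bochnerRieszSymbol s ((2 * Real.pi) • η) : ℂ) * 𝓕 f η)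

/-- `G` is the entire function of `z` that continues the values at `x` of
`Γ(s+1)⁻¹ S ^ s f`, `s > -1` real. -/
def IsBochnerRieszContinuation {n : ℕ} (f : EuclideanSpace ℝ (Fin n) → ℂ)
    (x : EuclideanSpace ℝ (Fin n)) (G : ℂ → ℂ) : Prop :=
  Differentiable ℂ G ∧
    ∀ s : ℝ, -1 < s → G (s : ℂ) = (Complex.Gamma ((s : ℂ) + 1))⁻¹ * bochnerRiesz s f x

/-- The analytic continuation is unique. -/
theorem IsBochnerRieszContinuation.unique {n : ℕ} {f : EuclideanSpace ℝ (Fin n) → ℂ}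
    {x : EuclideanSpace ℝ (Fin n)} {G H : ℂ → ℂ} (hG : IsBochnerRieszContinuation f x G)
    (hH : IsBochnerRieszContinuation f x H) : G = H := by
  have h0 : Tendsto (fun k : ℕ => (((1 : ℝ) / ((k : ℝ) + 1) : ℝ) : ℂ)) atTop (𝓝[≠] 0) := by
    refine tendsto_nhdsWithin_iff.2 ⟨?_, Eventually.of_forall fun k => ?_⟩
    · have h := (Complex.continuous_ofReal.tendsto 0).comp
        (tendsto_one_div_add_atTop_nhds_zero_nat (𝕜 := ℝ))
      simpa [Function.comp_def] using h
    · have : (0 : ℝ) < 1 / ((k : ℝ) + 1) := by positivity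
      simpa using (Complex.ofReal_ne_zero.2 this.ne')
  refine AnalyticOnNhd.eq_of_frequently_eq (z₀ := 0)
    (fun z _ => hG.1.analyticAt z) (fun z _ => hH.1.analyticAt z) ?_
  refine h0.frequently (Frequently.of_forall fun k => ?_)
  have hk : (-1 : ℝ) < 1 / ((k : ℝ) + 1) := by
    have : (0 : ℝ) < 1 / ((k : ℝ) + 1) := by positivity
    linarith
  rw [hG.2 _ hk, hH.2 _ hk]

/-- `v = S̃ ^ z f`, for the analytic family of Bochner–Riesz operators
`S̃ ^ s = Γ(s+1)⁻¹ S ^ s` (`s > -1`), continued analytically to all complex `z`. -/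
def IsAnalyticBochnerRiesz {n : ℕ} (z : ℂ) (f v : EuclideanSpace ℝ (Fin n) → ℂ) : Prop :=
  ∀ x, ∃ G : ℂ → ℂ, IsBochnerRieszContinuation f x G ∧ v x = G z

/-- The linear operator `T : L^p → L^q` extends `S̃ ^ z`, which is given by analytic continuation
on the compactly supported functions in `L^p`. -/
def ExtendsAnalyticBochnerRiesz {n : ℕ} {p q : ℝ≥0∞} (z : ℂ)
    (T : Lp ℂ p (volume : Measure (EuclideanSpace ℝ (Fin n))) →ₗ[ℂ]
      Lp ℂ q (volume : Measure (EuclideanSpace ℝ (Fin n)))) : Prop :=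
  ∀ (f : EuclideanSpace ℝ (Fin n) → ℂ) (hf : MemLp f p volume), HasCompactSupport f →
    ∃ v, IsAnalyticBochnerRiesz z f v ∧ T (hf.toLp f) =ᵐ[volume] v

/-- The factor `(z + 2) Γ(z + 1)`, with its limit `-1` at the removable singularity `z = -2`. -/
def bochnerRieszFactor (z : ℂ) : ℂ :=
  open Classical in if z = -2 then -1 else (z + 2) * Complex.Gamma (z + 1)

/-- The value `-1` is the limit of `(z + 2) Γ(z + 1)` at `-2`. -/
theorem continuousAt_bochnerRieszFactor : ContinuousAt bochnerRieszFactor (-2) := by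
  have hg : ContinuousAt (fun z : ℂ => Complex.Gamma (z + 3) / (z + 1)) (-2) := by
    have h1 : ContinuousAt Complex.Gamma (-2 + 3) := by
      have : (-2 + 3 : ℂ) = 1 := by norm_num
      rw [this]
      exact Complex.continuousAt_Gamma_one
    have h2 : ContinuousAt (fun z : ℂ => Complex.Gamma (z + 3)) (-2) :=
      ContinuousAt.comp (f := fun z : ℂ => z + 3) h1 (by fun_prop)
    exact h2.div (by fun_prop) (by norm_num)
  refine hg.congr ?_
  have hne : ∀ᶠ z : ℂ in 𝓝 (-2), z ≠ -1 := isOpen_ne.mem_nhds (by norm_num)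
  filter_upwards [hne] with z hz
  have hz1 : z + 1 ≠ 0 := fun h => hz (eq_neg_of_add_eq_zero_left h)
  unfold bochnerRieszFactor
  split_ifs with h
  · subst h
    norm_num
  · have hz2 : z + 2 ≠ 0 := fun h' => h (eq_neg_of_add_eq_zero_left h')
    have e1 : Complex.Gamma (z + 3) = (z + 2) * Complex.Gamma (z + 2) := by
      rw [← Complex.Gamma_add_one _ hz2]; congr 1; ring
    have e2 : Complex.Gamma (z + 2) = (z + 1) * Complex.Gamma (z + 1) := by
      rw [← Complex.Gamma_add_one _ hz1]; congr 1; ring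
    rw [e1, e2]
    field_simp

/-- The exponent `p = (2n+2)/(n+1+4β)`. -/
def sourceExponent (n : ℕ) (β : ℝ) : ℝ≥0∞ :=
  ENNReal.ofReal (2 * n + 2) / ENNReal.ofReal (n + 1 + 4 * β)

/-- The exponent `q = (2n+2)/(n+1-4β)`, which is `∞` for `β = (n+1)/4`. -/
def targetExponent (n : ℕ) (β : ℝ) : ℝ≥0∞ :=
  ENNReal.ofReal (2 * n + 2) / ENNReal.ofReal (n + 1 - 4 * β)

end

/-!
For every `z`, the operator `S̃ ^ z` is the convolution with a kernel which is entire in `z`: up to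
constants, the Bessel function of `|x|` of order `z + n/2`, divided by `|x| ^ (z + n/2)`. On the
line `Re z = -(n+1)/2` this kernel is bounded in `x`, because the decay `|x| ^ (-1/2)` of the Bessel
function makes up for the growth `|x| ^ (1/2)` of the other factor; hence `S̃ ^ z` maps `L¹` to
`L^∞`. On the line `Re z = 0` the multiplier `Γ(z+1)⁻¹ (1 - |ξ|²)₊ ^ z` is bounded in `ξ`, and
Plancherel's theorem gives a bound on `L²`. Stein's interpolation theorem then yields `L^p → L^q`
bounds in the strip between the two lines, with `1/p + 1/q = 1`.

Both bounds grow exponentially in `|Im z|`. The growth is that of `Γ(z+1)⁻¹`, so that it is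
compensated by the weight `H(z) = Γ(z+m+1) / (z+n+2)^m`, where `m` is so large that `H` has no poles
and no zeros in the strip. The interpolated bound for `H(z) S̃ ^ z` loses only one power of `|Im z|`
when `H` is replaced by `(z+2) Γ(z+1)`, as the quotient of the two is rational.
-/

noncomputable section

open Complex (Gamma I)
open Module (finrank)
open scoped Real SchwartzMap

/-- The profile `(1 - r²)₊ ^ z` of the Bochner–Riesz symbol, for a complex exponent. -/
def ballProfile (z : ℂ) (r : ℝ) : ℂ := if r < 1 then ((1 - r ^ 2 : ℝ) : ℂ) ^ z else 0

section Mellin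

lemma mellin_indicator_one_sub_cpow (s z : ℂ) :
    mellin ((Set.Iio 1).indicator fun u : ℝ => (1 - (u : ℂ)) ^ z) s =
      Complex.betaIntegral s (z + 1) := by
  simp only [mellin, Complex.betaIntegral, ← Set.indicator_smul, add_sub_cancel_right]
  rw [setIntegral_indicator measurableSet_Iio, Set.Ioi_inter_Iio,
    intervalIntegral.integral_of_le zero_le_one, integral_Ioc_eq_integral_Ioo]
  rfl

lemma mellinConvergent_indicator_one_sub_cpow {s z : ℂ} (hs : 0 < s.re) (hz : -1 < z.re) :
    MellinConvergent ((Set.Iio 1).indicator fun u : ℝ => (1 - (u : ℂ)) ^ z) s := by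
  have h := Complex.betaIntegral_convergent hs
    (show 0 < (z + 1).re by rw [Complex.add_re, Complex.one_re]; linarith)
  rw [intervalIntegrable_iff_integrableOn_Ioo_of_le zero_le_one, add_sub_cancel_right] at h
  rw [MellinConvergent, ← integrable_indicator_iff measurableSet_Ioi]
  refine ((integrable_indicator_iff measurableSet_Ioo).2 h).congr (Eventually.of_forall fun u => ?_)
  simp only [Set.indicator_apply, Set.mem_Ioo, Set.mem_Ioi, Set.mem_Iio, smul_eq_mul, mul_ite,
    mul_zero, ite_and]

lemma ballProfile_eqOn_comp_rpow (z : ℂ) :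
    Set.EqOn (ballProfile z)
      (fun r => (Set.Iio 1).indicator (fun u : ℝ => (1 - (u : ℂ)) ^ z) (r ^ (2 : ℝ)))
      (Set.Ioi 0) := by
  intro r hr
  have hlt : r ^ 2 < 1 ↔ r < 1 := by
    rw [sq_lt_one_iff_abs_lt_one, abs_of_pos hr]
  simp only [ballProfile, Set.indicator, Set.mem_Iio, Real.rpow_two, hlt]
  push_cast
  rfl

lemma mellin_ballProfile {s z : ℂ} (hs : 0 < s.re) (hz : -1 < z.re) :
    mellin (ballProfile z) s = 2⁻¹ * (Gamma (s / 2) * Gamma (z + 1) / Gamma (s / 2 + (z + 1))) := by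
  have hs2 : 0 < (s / 2).re := by rw [Complex.div_ofNat_re]; positivity
  have hz1 : 0 < (z + 1).re := by rw [Complex.add_re, Complex.one_re]; linarith
  have h : mellin (ballProfile z) s = mellin (fun r =>
      (Set.Iio 1).indicator (fun u : ℝ => (1 - (u : ℂ)) ^ z) (r ^ (2 : ℝ))) s :=
    setIntegral_congr_fun measurableSet_Ioi fun r hr => by
      simp only [ballProfile_eqOn_comp_rpow z hr]
  rw [h, mellin_comp_rpow, Complex.ofReal_ofNat, mellin_indicator_one_sub_cpow,
    Complex.betaIntegral_eq_Gamma_mul_div _ _ hs2 hz1, abs_two, Complex.real_smul]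
  push_cast
  rfl

lemma mellinConvergent_ballProfile {s z : ℂ} (hs : 0 < s.re) (hz : -1 < z.re) :
    MellinConvergent (ballProfile z) s := by
  have hs2 : 0 < (s / (2 : ℝ)).re := by rw [Complex.div_ofReal_re]; positivity
  refine ((MellinConvergent.comp_rpow two_ne_zero).2
    (mellinConvergent_indicator_one_sub_cpow hs2 hz)).congr_fun (fun r hr => ?_) measurableSet_Ioi
  simp only [ballProfile_eqOn_comp_rpow z hr]

lemma mellin_exp_neg_sq {s : ℂ} (hs : 0 < s.re) :
    mellin (fun r => Complex.exp (-(r : ℂ) ^ 2)) s = 2⁻¹ * Gamma (s / 2) := by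
  have h : (fun r : ℝ => Complex.exp (-(r : ℂ) ^ 2)) =
      fun r => (fun t : ℝ => (Real.exp (-t) : ℂ)) (r ^ (2 : ℝ)) := by
    ext r; simp
  rw [h, mellin_comp_rpow (fun t : ℝ => (Real.exp (-t) : ℂ)),
    ← Complex.GammaIntegral_eq_mellin, Complex.ofReal_ofNat,
    ← Complex.Gamma_eq_integral (by rw [Complex.div_ofNat_re]; positivity), abs_two,
    Complex.real_smul]
  push_cast
  rfl

end Mellin

section Polar

variable {V : Type*} [NormedAddCommGroup V] [NormedSpace ℝ V] [FiniteDimensional ℝ V]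
  [MeasurableSpace V] [BorelSpace V] [Nontrivial V] (μ : Measure V) [μ.IsAddHaarMeasure]

lemma integral_volumeIoiPow {F : Type*} [NormedAddCommGroup F] [NormedSpace ℝ F] (m : ℕ)
    (g : ℝ → F) :
    ∫ r : Set.Ioi (0 : ℝ), g r ∂.volumeIoiPow m = ∫ r in Set.Ioi (0 : ℝ), r ^ m • g r := by
  simp only [Measure.volumeIoiPow, ENNReal.ofReal]
  rw [integral_withDensity_eq_integral_smul (measurable_subtype_coe.pow_const _).real_toNNReal,
    integral_subtype_comap measurableSet_Ioi fun r : ℝ => Real.toNNReal (r ^ m) • g r]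
  refine setIntegral_congr_fun measurableSet_Ioi fun r hr => ?_
  rw [NNReal.smul_def, Real.coe_toNNReal _ (pow_nonneg (le_of_lt hr) _)]

lemma integral_radial_mul_homogeneous (g : ℝ → ℂ) {P : V → ℂ} {k : ℕ}
    (hP : ∀ r : ℝ, ∀ ω, P (r • ω) = r ^ k * P ω) :
    ∫ ξ, g ‖ξ‖ * P ξ ∂μ = (∫ ω, P (ω : V) ∂μ.toSphere) * mellin g (finrank ℝ V + k) := by
  calc
    ∫ ξ, g ‖ξ‖ * P ξ ∂μ
      = ∫ ξ : ({(0)}ᶜ : Set V), g ‖ξ.1‖ * P ξ.1 ∂(μ.comap (↑)) := by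
      rw [integral_subtype_comap (measurableSet_singleton _).compl fun ξ : V => g ‖ξ‖ * P ξ,
        restrict_compl_singleton]
    _ = ∫ p, P (p.1 : V) * ((p.2 : ℂ) ^ k * g p.2)
          ∂μ.toSphere.prod (.volumeIoiPow (finrank ℝ V - 1)) := by
      rw [← μ.measurePreserving_homeomorphUnitSphereProd.integral_comp
        (Homeomorph.measurableEmbedding _)]
      refine integral_congr_ae (Eventually.of_forall fun ξ => ?_)
      have hξ : (‖ξ.1‖ : ℂ) ≠ 0 := Complex.ofReal_ne_zero.2 (norm_ne_zero_iff.2 ξ.2)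
      simp only [homeomorphUnitSphereProd_apply_snd_coe, homeomorphUnitSphereProd_apply_fst_coe, hP]
      push_cast
      rw [inv_pow]
      field_simp
    _ = (∫ ω, P (ω : V) ∂μ.toSphere) *
          ∫ r in Set.Ioi (0 : ℝ), r ^ (finrank ℝ V - 1) • ((r : ℂ) ^ k * g r) := by
      rw [integral_prod_mul (fun ω : Metric.sphere (0 : V) 1 => P (ω : V))
        (fun r : Set.Ioi (0 : ℝ) => (r : ℂ) ^ k * g r),
        integral_volumeIoiPow _ fun r : ℝ => (r : ℂ) ^ k * g r]
    _ = _ := by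
      congr 1
      refine setIntegral_congr_fun measurableSet_Ioi fun r _ => ?_
      have hd : ((finrank ℝ V : ℂ) + k - 1) = ((finrank ℝ V - 1 + k : ℕ) : ℂ) := by
        push_cast [Nat.cast_sub (Module.finrank_pos (R := ℝ) (M := V))]
        ring
      simp only [hd, Complex.cpow_natCast, Complex.real_smul, smul_eq_mul, pow_add]
      push_cast
      ring

lemma integrable_comp_norm_iff_mellinConvergent (g : ℝ → ℂ) :
    Integrable (fun ξ => g ‖ξ‖) μ ↔ MellinConvergent g (finrank ℝ V) := by
  rw [integrable_fun_norm_addHaar, MellinConvergent]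
  refine integrableOn_congr_fun (fun r _ => ?_) measurableSet_Ioi
  rw [← Nat.cast_pred (Module.finrank_pos (R := ℝ) (M := V)), Complex.cpow_natCast,
    ← Complex.ofReal_pow, Complex.coe_smul]

lemma integrable_ballProfile_norm {z : ℂ} (hz : -1 < z.re) :
    Integrable (fun ξ => ballProfile z ‖ξ‖) μ :=
  (integrable_comp_norm_iff_mellinConvergent μ _).2 <| mellinConvergent_ballProfile
    (by rw [Complex.natCast_re]; exact_mod_cast Module.finrank_pos (R := ℝ) (M := V)) hz

end Polar

section Moments

lemma hasSum_ite_even_iff {a : ℕ → ℂ} {s : ℂ} :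
    HasSum (fun k => if Even k then a (k / 2) else 0) s ↔ HasSum a s := by
  rw [← (mul_right_injective₀ (two_ne_zero (α := ℕ))).hasSum_iff]
  · simp only [Function.comp_def, even_two_mul, if_true, Nat.mul_div_cancel_left _ two_pos]
  · rintro m hm
    rw [if_neg]
    rintro ⟨j, rfl⟩
    exact hm ⟨j, two_mul j⟩

lemma eq_of_forall_hasSum_pow_mul {a b : ℕ → ℂ} {f : ℂ → ℂ}
    (ha : ∀ c : ℂ, HasSum (fun k => c ^ k * a k) (f c))
    (hb : ∀ c : ℂ, HasSum (fun k => c ^ k * b k) (f c)) : a = b := by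
  have hasFPowerSeries : ∀ u : ℕ → ℂ, (∀ c : ℂ, HasSum (fun k => c ^ k * u k) (f c)) →
      HasFPowerSeriesAt f (FormalMultilinearSeries.ofScalars ℂ u) 0 := fun u hu => by
    rw [hasFPowerSeriesAt_iff]
    refine Eventually.of_forall fun c => ?_
    simpa [FormalMultilinearSeries.coeff_ofScalars] using hu c
  have heq := (hasFPowerSeries a ha).eq_formalMultilinearSeries (hasFPowerSeries b hb)
  ext k
  simpa [FormalMultilinearSeries.coeff_ofScalars] using
    congrArg (fun p : FormalMultilinearSeries ℂ ℂ ℂ => p.coeff k) heq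

variable {V : Type*} [NormedAddCommGroup V] [InnerProductSpace ℝ V] [FiniteDimensional ℝ V]
  [MeasurableSpace V] [BorelSpace V]

lemma hasSum_integral_mul_inner_pow {μ : Measure V} {φ : V → ℂ} (c : ℂ) (x : V)
    (hφ : AEStronglyMeasurable φ μ)
    (hint : Integrable (fun ξ => ‖φ ξ‖ * Real.exp (‖c‖ * ‖x‖ * ‖ξ‖)) μ) :
    HasSum (fun k : ℕ => c ^ k / (k.factorial : ℂ) * ∫ ξ, φ ξ * (inner ℝ x ξ : ℂ) ^ k ∂μ)
      (∫ ξ, φ ξ * Complex.exp (c * (inner ℝ x ξ : ℂ)) ∂μ) := by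
  simp only [← integral_const_mul]
  have hbound : ∀ ξ, HasSum (fun k : ℕ => ‖φ ξ‖ * ((‖c‖ * ‖x‖ * ‖ξ‖) ^ k / (k.factorial : ℝ)))
      (‖φ ξ‖ * Real.exp (‖c‖ * ‖x‖ * ‖ξ‖)) := fun ξ => by
    rw [Real.exp_eq_exp_ℝ]
    exact (NormedSpace.expSeries_div_hasSum_exp (‖c‖ * ‖x‖ * ‖ξ‖)).mul_left _
  refine hasSum_integral_of_dominated_convergence
    (fun k ξ => ‖φ ξ‖ * ((‖c‖ * ‖x‖ * ‖ξ‖) ^ k / (k.factorial : ℝ)))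
    (fun k => ?_) (fun k => Eventually.of_forall fun ξ => ?_)
    (Eventually.of_forall fun ξ => (hbound ξ).summable) ?_ (Eventually.of_forall fun ξ => ?_)
  · exact (hφ.mul (by fun_prop)).const_mul _
  · have hinner : ‖inner ℝ x ξ‖ ≤ ‖x‖ * ‖ξ‖ := norm_inner_le_norm x ξ
    rw [norm_mul, norm_mul, norm_div, norm_pow, norm_pow, Complex.norm_natCast, Complex.norm_real]
    calc ‖c‖ ^ k / k.factorial * (‖φ ξ‖ * ‖inner ℝ x ξ‖ ^ k)
        ≤ ‖c‖ ^ k / k.factorial * (‖φ ξ‖ * (‖x‖ * ‖ξ‖) ^ k) := by gcongr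
      _ = ‖φ ξ‖ * ((‖c‖ * ‖x‖ * ‖ξ‖) ^ k / k.factorial) := by ring
  · simpa only [(hbound _).tsum_eq] using hint
  · rw [Complex.exp_eq_exp_ℂ]
    refine ((NormedSpace.expSeries_div_hasSum_exp _).mul_left (φ ξ)).congr_fun fun k => ?_
    ring

lemma integrable_exp_neg_sq_mul_exp (b : ℝ) :
    Integrable (fun ξ : V => Real.exp (-‖ξ‖ ^ 2) * Real.exp (b * ‖ξ‖)) := by
  have hgauss : Integrable (fun ξ : V => Real.exp (-(1 / 2) * ‖ξ‖ ^ 2)) := by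
    have h := (GaussianFourier.integrable_cexp_neg_mul_sq_norm_add (V := V) (b := 1 / 2)
      (by norm_num) 0 0).norm
    refine h.congr (Eventually.of_forall fun ξ => ?_)
    simp [Complex.norm_exp, ← Complex.ofReal_pow]
  refine (hgauss.const_mul (Real.exp (b ^ 2 / 2))).mono' (by fun_prop)
    (Eventually.of_forall fun ξ => ?_)
  rw [Real.norm_of_nonneg (by positivity), ← Real.exp_add, ← Real.exp_add]
  exact Real.exp_le_exp.2 (by nlinarith [sq_nonneg (b - ‖ξ‖)])

/-- The moment of order `k` of the Gaussian `exp (-|ξ|²)` in the direction of `x`. As the moments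
of all radial functions are proportional, it is the yardstick for those of `ballProfile`. -/
def gaussianMoment (x : V) (k : ℕ) : ℂ :=
  ∫ ξ : V, Complex.exp (-(‖ξ‖ : ℂ) ^ 2) * (inner ℝ x ξ : ℂ) ^ k

lemma hasSum_gaussianMoment (x : V) (c : ℂ) :
    HasSum (fun k : ℕ => c ^ k / (k.factorial : ℂ) * gaussianMoment x k)
      ((π : ℂ) ^ (finrank ℝ V / 2 : ℂ) * Complex.exp (c ^ 2 * ‖x‖ ^ 2 / 4)) := by
  have hint : Integrable (fun ξ : V => ‖Complex.exp (-(‖ξ‖ : ℂ) ^ 2)‖ *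
      Real.exp (‖c‖ * ‖x‖ * ‖ξ‖)) := by
    refine (integrable_exp_neg_sq_mul_exp (‖c‖ * ‖x‖)).congr (Eventually.of_forall fun ξ => ?_)
    simp [Complex.norm_exp, ← Complex.ofReal_pow]
  have h := GaussianFourier.integral_cexp_neg_mul_sq_norm_add (V := V) (b := 1) (by norm_num) c x
  simp only [div_one, mul_one, neg_one_mul, Complex.exp_add] at h
  rw [← h]
  exact hasSum_integral_mul_inner_pow c x (by fun_prop) hint

lemma gaussianMoment_eq (x : V) (k : ℕ) :
    gaussianMoment x k = if Even k then (π : ℂ) ^ (finrank ℝ V / 2 : ℂ) *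
      (k.factorial * (‖x‖ ^ 2 / 4) ^ (k / 2) / (k / 2).factorial) else 0 := by
  have hleft : ∀ c : ℂ, HasSum (fun k : ℕ => c ^ k * (gaussianMoment x k / k.factorial))
      ((π : ℂ) ^ (finrank ℝ V / 2 : ℂ) * Complex.exp (c ^ 2 * ‖x‖ ^ 2 / 4)) := fun c =>
    (hasSum_gaussianMoment x c).congr_fun fun k => by ring
  have hright : ∀ c : ℂ, HasSum (fun k : ℕ => c ^ k * (if Even k then
      (π : ℂ) ^ (finrank ℝ V / 2 : ℂ) * ((‖x‖ ^ 2 / 4) ^ (k / 2) / (k / 2).factorial) else 0))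
      ((π : ℂ) ^ (finrank ℝ V / 2 : ℂ) * Complex.exp (c ^ 2 * ‖x‖ ^ 2 / 4)) := fun c => by
    rw [Complex.exp_eq_exp_ℂ]
    refine (hasSum_ite_even_iff.2 ((NormedSpace.expSeries_div_hasSum_exp
      (c ^ 2 * ‖x‖ ^ 2 / 4 : ℂ)).mul_left ((π : ℂ) ^ (finrank ℝ V / 2 : ℂ)))).congr_fun fun k => ?_
    rw [mul_ite, mul_zero]
    refine if_ctx_congr Iff.rfl (fun hk => ?_) fun _ => rfl
    rw [mul_div_assoc, mul_pow, ← pow_mul, Nat.mul_div_cancel' hk.two_dvd]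
    ring
  have h := congrFun (eq_of_forall_hasSum_pow_mul hleft hright) k
  rw [div_eq_iff (Nat.cast_ne_zero.2 k.factorial_ne_zero), ite_mul, zero_mul] at h
  rw [h]
  refine if_ctx_congr Iff.rfl (fun _ => ?_) fun _ => rfl
  ring

lemma integral_radial_mul_inner_pow [Nontrivial V] (g : ℝ → ℂ) (x : V) (k : ℕ) :
    ∫ ξ : V, g ‖ξ‖ * (inner ℝ x ξ : ℂ) ^ k =
      (∫ ω, (inner ℝ x (ω : V) : ℂ) ^ k ∂(volume : Measure V).toSphere) *
        mellin g (finrank ℝ V + k) :=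
  integral_radial_mul_homogeneous volume g fun r ω => by
    rw [real_inner_smul_right, Complex.ofReal_mul, mul_pow]

lemma integral_ballProfile_mul_inner_pow [Nontrivial V] {z : ℂ} (hz : -1 < z.re) (x : V) (k : ℕ) :
    ∫ ξ : V, ballProfile z ‖ξ‖ * (inner ℝ x ξ : ℂ) ^ k =
      gaussianMoment x k * (Gamma (z + 1) / Gamma (((finrank ℝ V : ℂ) + k) / 2 + (z + 1))) := by
  have hdim : 0 < ((finrank ℝ V : ℂ) + k).re := by
    have : 0 < finrank ℝ V := Module.finrank_pos
    rw [Complex.add_re, Complex.natCast_re, Complex.natCast_re]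
    positivity
  rw [integral_radial_mul_inner_pow, mellin_ballProfile hdim hz, gaussianMoment,
    integral_radial_mul_inner_pow (fun r : ℝ => Complex.exp (-(r : ℂ) ^ 2)),
    mellin_exp_neg_sq hdim]
  ring

end Moments

/-- The entire function `(w, r) ↦ (r / 2) ^ (1 - w) J_(w-1)(r) = ∑ (-r²/4)^j / (j! Γ(w+j))`, a
Bessel function freed of its singularities. -/
def besselClifford (w : ℂ) (r : ℝ) : ℂ :=
  ∑' j : ℕ, ((-(r ^ 2 / 4) : ℝ) : ℂ) ^ j / (j.factorial : ℂ) * (Gamma (w + j))⁻¹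

lemma integral_ballProfile_mul_exp {V : Type*} [NormedAddCommGroup V] [InnerProductSpace ℝ V]
    [FiniteDimensional ℝ V] [MeasurableSpace V] [BorelSpace V] [Nontrivial V] {z : ℂ}
    (hz : -1 < z.re) (x : V) :
    ∫ ξ : V, ballProfile z ‖ξ‖ * Complex.exp (I * (inner ℝ x ξ : ℂ)) =
      Gamma (z + 1) * (π : ℂ) ^ (finrank ℝ V / 2 : ℂ) *
        besselClifford (z + finrank ℝ V / 2 + 1) ‖x‖ := by
  have hball := integrable_ballProfile_norm (volume : Measure V) hz
  have hint : Integrable (fun ξ : V => ‖ballProfile z ‖ξ‖‖ * Real.exp (‖I‖ * ‖x‖ * ‖ξ‖)) := by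
    refine (hball.norm.mul_const (Real.exp ‖x‖)).mono'
      (hball.1.norm.mul (by fun_prop)) (Eventually.of_forall fun ξ => ?_)
    rw [Real.norm_of_nonneg (by positivity), Complex.norm_I, one_mul]
    by_cases hξ : ‖ξ‖ < 1
    · gcongr
      exact mul_le_of_le_one_right (norm_nonneg x) hξ.le
    · simp [ballProfile, hξ]
  have hsum := hasSum_integral_mul_inner_pow I x hball.1 hint
  simp only [integral_ballProfile_mul_inner_pow hz, gaussianMoment_eq] at hsum
  rw [besselClifford, ← tsum_mul_left]
  refine (hasSum_ite_even_iff.1 (hsum.congr_fun fun k => ?_)).tsum_eq.symm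
  rw [ite_mul, zero_mul, mul_ite, mul_zero]
  refine if_ctx_congr Iff.rfl (fun hk => ?_) fun _ => rfl
  obtain ⟨j, rfl⟩ := hk.two_dvd
  have hfac : ((2 * j).factorial : ℂ) ≠ 0 := Nat.cast_ne_zero.2 (Nat.factorial_ne_zero _)
  have harg : ((finrank ℝ V : ℂ) + (2 * j : ℕ)) / 2 + (z + 1) = z + finrank ℝ V / 2 + 1 + j := by
    push_cast; ring
  rw [harg, pow_mul, Complex.I_sq, Nat.mul_div_cancel_left _ two_pos]
  push_cast
  rw [neg_pow ((‖x‖ : ℂ) ^ 2 / 4)]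
  field_simp

section BesselClifford

lemma exists_forall_norm_inv_Gamma_add_nat_le (R : ℝ) :
    ∃ M : ℝ, ∀ w : ℂ, ‖w‖ ≤ R → ∀ j : ℕ, ‖(Gamma (w + j))⁻¹‖ ≤ M := by
  obtain ⟨K, hK⟩ := exists_nat_ge (R + 1)
  obtain ⟨M, hM⟩ := (isCompact_closedBall (0 : ℂ) (R + K)).exists_bound_of_continuousOn
    Complex.differentiable_one_div_Gamma.continuous.continuousOn
  have hball : ∀ w : ℂ, ‖w‖ ≤ R → ∀ j : ℕ, j ≤ K → ‖(Gamma (w + j))⁻¹‖ ≤ M := by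
    intro w hw j hj
    refine hM _ ?_
    rw [mem_closedBall_zero_iff]
    refine (norm_add_le _ _).trans (add_le_add hw ?_)
    rw [Complex.norm_natCast]
    exact_mod_cast hj
  refine ⟨M, fun w hw j => ?_⟩
  rcases le_total j K with hj | hj
  · exact hball w hw j hj
  · induction j, hj using Nat.le_induction with
    | base => exact hball w hw K le_rfl
    | succ j hj ih =>
      have h1 : 1 ≤ ‖w + j‖ := by
        have h2 : ‖(j : ℂ)‖ ≤ ‖w + j‖ + ‖w‖ := by
          simpa using norm_sub_le (w + j) w
        rw [Complex.norm_natCast] at h2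
        have h3 : (K : ℝ) ≤ j := by exact_mod_cast hj
        linarith
      rw [Complex.one_div_Gamma_eq_self_mul_one_div_Gamma_add_one, norm_mul] at ih
      push_cast
      rw [← add_assoc]
      exact (le_mul_of_one_le_left (norm_nonneg _) h1).trans ih

lemma exists_summable_bound_besselClifford (R : ℝ) :
    ∃ u : ℕ → ℝ, Summable u ∧ ∀ w : ℂ, ‖w‖ ≤ R → ∀ r : ℝ, |r| ≤ R → ∀ j : ℕ,
      ‖((-(r ^ 2 / 4) : ℝ) : ℂ) ^ j / (j.factorial : ℂ) * (Gamma (w + j))⁻¹‖ ≤ u j := by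
  obtain ⟨M, hM⟩ := exists_forall_norm_inv_Gamma_add_nat_le R
  refine ⟨fun j => (R ^ 2 / 4) ^ j / (j.factorial : ℝ) * M,
    (Real.summable_pow_div_factorial _).mul_right M, fun w hw r hr j => ?_⟩
  rw [norm_mul, norm_div, norm_pow, Complex.norm_real, Complex.norm_natCast, norm_neg,
    Real.norm_of_nonneg (by positivity)]
  have h1 : r ^ 2 ≤ R ^ 2 := sq_le_sq' (by linarith [neg_abs_le r]) ((le_abs_self r).trans hr)
  change _ ≤ (R ^ 2 / 4) ^ j / (j.factorial : ℝ) * M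
  gcongr
  exact hM w hw j

lemma continuous_besselClifford : Continuous fun p : ℂ × ℝ => besselClifford p.1 p.2 := by
  rw [continuous_iff_continuousAt]
  rintro ⟨w₀, r₀⟩
  set R : ℝ := max ‖w₀‖ |r₀| + 1
  obtain ⟨u, hu, hb⟩ := exists_summable_bound_besselClifford R
  have hopen : IsOpen {p : ℂ × ℝ | ‖p.1‖ < R ∧ |p.2| < R} :=
    (isOpen_lt (f := fun p : ℂ × ℝ => ‖p.1‖) (g := fun _ => R) (by fun_prop) (by fun_prop)).inter
      (isOpen_lt (f := fun p : ℂ × ℝ => |p.2|) (g := fun _ => R) (by fun_prop) (by fun_prop))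
  refine ContinuousOn.continuousAt (s := {p : ℂ × ℝ | ‖p.1‖ < R ∧ |p.2| < R}) ?_
    (hopen.mem_nhds ⟨?_, ?_⟩)
  · refine continuousOn_tsum (fun j => Continuous.continuousOn ?_) hu
      fun j p hp => hb p.1 hp.1.le p.2 hp.2.le j
    have := Complex.differentiable_one_div_Gamma.continuous.comp
      (show Continuous fun p : ℂ × ℝ => p.1 + j by fun_prop)
    exact Continuous.mul (by fun_prop) this
  · exact (le_max_left _ _).trans_lt (lt_add_one _)
  · exact (le_max_right _ _).trans_lt (lt_add_one _)

lemma differentiable_besselClifford (r : ℝ) :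
    Differentiable ℂ fun w : ℂ => besselClifford w r := by
  intro w₀
  set R : ℝ := max ‖w₀‖ |r| + 1
  obtain ⟨u, hu, hb⟩ := exists_summable_bound_besselClifford R
  have hr : |r| ≤ R := (le_max_right _ _).trans (le_add_of_nonneg_right zero_le_one)
  have h : DifferentiableOn ℂ (fun w : ℂ => besselClifford w r) (Metric.ball 0 R) := by
    refine Complex.differentiableOn_tsum_of_summable_norm hu (fun j => ?_) Metric.isOpen_ball
      fun j w hw => hb w (mem_ball_zero_iff.1 hw).le r hr j
    have := Complex.differentiable_one_div_Gamma.comp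
      (show Differentiable ℂ fun w : ℂ => w + j by fun_prop)
    exact (this.const_mul _).differentiableOn
  refine h.differentiableAt (Metric.isOpen_ball.mem_nhds ?_)
  rw [mem_ball_zero_iff]
  exact (le_max_left _ _).trans_lt (lt_add_one _)

end BesselClifford

section Oscillatory

lemma norm_one_sub_sq_cpow_le {α : ℝ} {a : ℂ} (ha : α ≤ a.re) {t : ℝ} (h0 : 0 ≤ t)
    (h1 : t < 1) : ‖((1 - t ^ 2 : ℝ) : ℂ) ^ a‖ ≤ (1 - t ^ 2) ^ α := by
  have hpos : 0 < 1 - t ^ 2 := by nlinarith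
  rw [Complex.norm_cpow_eq_rpow_re_of_pos hpos]
  exact Real.rpow_le_rpow_of_exponent_ge hpos (by nlinarith) ha

lemma hasDerivAt_one_sub_sq (t : ℝ) : HasDerivAt (fun t : ℝ => 1 - t ^ 2) (-(2 * t)) t := by
  simpa using (hasDerivAt_pow 2 t).const_sub 1

lemma hasDerivAt_one_sub_sq_cpow (a : ℂ) {t : ℝ} (h0 : 0 ≤ t) (h1 : t < 1) :
    HasDerivAt (fun t : ℝ => ((1 - t ^ 2 : ℝ) : ℂ) ^ a)
      (a * ((1 - t ^ 2 : ℝ) : ℂ) ^ (a - 1) * ((-(2 * t) : ℝ) : ℂ)) t := by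
  have hpos : 0 < 1 - t ^ 2 := by nlinarith
  exact (Complex.hasStrictDerivAt_cpow_const
    (Complex.ofReal_mem_slitPlane.2 hpos)).hasDerivAt.comp t (hasDerivAt_one_sub_sq t).ofReal_comp

lemma integrableOn_one_sub_sq_cpow {a : ℂ} (ha : -1 < a.re) :
    IntegrableOn (fun t : ℝ => ((1 - t ^ 2 : ℝ) : ℂ) ^ a) (Set.Ioo 0 1) := by
  have h := (mellinConvergent_ballProfile (s := 1) one_pos ha).mono_set
    (Set.Ioo_subset_Ioi_self : Set.Ioo (0 : ℝ) 1 ⊆ Set.Ioi 0)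
  refine h.congr_fun (fun t ht => ?_) measurableSet_Ioo
  simp [ballProfile, ht.2]

lemma intervalIntegrable_one_sub_sq_cpow {a : ℂ} (ha : -1 < a.re) {b c : ℝ} (hb : 0 ≤ b)
    (hbc : b ≤ c) (hc : c ≤ 1) :
    IntervalIntegrable (fun t : ℝ => ((1 - t ^ 2 : ℝ) : ℂ) ^ a) volume b c := by
  rw [intervalIntegrable_iff_integrableOn_Ioo_of_le hbc]
  exact (integrableOn_one_sub_sq_cpow ha).mono_set (Set.Ioo_subset_Ioo hb hc)

lemma hasDerivAt_exp_I_mul (θ t : ℝ) :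
    HasDerivAt (fun t : ℝ => Complex.exp (I * ((θ * t : ℝ) : ℂ)))
      (Complex.exp (I * ((θ * t : ℝ) : ℂ)) * (I * θ)) t :=
  ((hasDerivAt_const_mul θ).ofReal_comp.const_mul I).cexp

lemma norm_exp_I_mul_ofReal (x : ℝ) : ‖Complex.exp (I * (x : ℂ))‖ = 1 := by
  rw [mul_comm, Complex.norm_exp_ofReal_mul_I]

lemma norm_integral_mul_exp_I_le_of_hasDerivAt {u u' : ℝ → ℂ} {g : ℝ → ℝ} {b c θ : ℝ}
    (hbc : b ≤ c) (hθ : θ ≠ 0) (hu : ∀ t ∈ Set.uIcc b c, HasDerivAt u (u' t) t)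
    (hu' : IntervalIntegrable u' volume b c) (hg : IntervalIntegrable g volume b c)
    (hle : ∀ t ∈ Set.Ioc b c, ‖u' t‖ ≤ g t) :
    ‖∫ t in b..c, u t * Complex.exp (I * ((θ * t : ℝ) : ℂ))‖ ≤
      (‖u c‖ + ‖u b‖ + ∫ t in b..c, g t) / |θ| := by
  have hIθ : I * (θ : ℂ) ≠ 0 := mul_ne_zero Complex.I_ne_zero (Complex.ofReal_ne_zero.2 hθ)
  have hprimitive : ∀ t : ℝ, HasDerivAt
      (fun t : ℝ => Complex.exp (I * ((θ * t : ℝ) : ℂ)) / (I * θ))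
      (Complex.exp (I * ((θ * t : ℝ) : ℂ))) t := fun t => by
    simpa only [mul_div_cancel_right₀ _ hIθ] using (hasDerivAt_exp_I_mul θ t).div_const (I * θ)
  have hnorm : ∀ t : ℝ, ‖Complex.exp (I * ((θ * t : ℝ) : ℂ)) / (I * θ)‖ = |θ|⁻¹ := fun t => by
    rw [norm_div, norm_exp_I_mul_ofReal, norm_mul, Complex.norm_I, one_mul, Complex.norm_real,
      Real.norm_eq_abs, one_div]
  have hint : ‖∫ t in b..c, u' t * (Complex.exp (I * ((θ * t : ℝ) : ℂ)) / (I * θ))‖ ≤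
      (∫ t in b..c, g t) * |θ|⁻¹ := by
    rw [← intervalIntegral.integral_mul_const]
    refine intervalIntegral.norm_integral_le_of_norm_le hbc
      (Eventually.of_forall fun t ht => ?_) (hg.mul_const _)
    rw [norm_mul, hnorm]
    exact mul_le_mul_of_nonneg_right (hle t ht) (by positivity)
  rw [intervalIntegral.integral_mul_deriv_eq_deriv_mul hu (fun t _ => hprimitive t) hu'
    (Continuous.intervalIntegrable (by fun_prop) _ _), div_eq_mul_inv (_ + _) |θ|, add_mul,
    add_mul]
  refine (norm_sub_le _ _).trans (add_le_add ((norm_sub_le _ _).trans (le_of_eq ?_)) hint)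
  rw [norm_mul, norm_mul, hnorm, hnorm]

lemma integral_two_mul_mul_inv_one_sub_sq_sq {b : ℝ} (hb0 : 0 ≤ b) (hb1 : b < 1) :
    IntervalIntegrable (fun t : ℝ => 2 * t * (1 - t ^ 2) ^ (-2 : ℝ)) volume 0 b ∧
      ∫ t in (0 : ℝ)..b, 2 * t * (1 - t ^ 2) ^ (-2 : ℝ) = (1 - b ^ 2)⁻¹ - 1 := by
  have hpos : ∀ t ∈ Set.uIcc 0 b, 0 < 1 - t ^ 2 := fun t ht => by
    rw [Set.uIcc_of_le hb0] at ht
    nlinarith [ht.1, ht.2]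
  have hderiv : ∀ t ∈ Set.uIcc 0 b, HasDerivAt (fun t : ℝ => (1 - t ^ 2)⁻¹)
      (2 * t * (1 - t ^ 2) ^ (-2 : ℝ)) t := fun t ht => by
    refine ((hasDerivAt_one_sub_sq t).inv (hpos t ht).ne').congr_deriv ?_
    rw [Real.rpow_neg (hpos t ht).le, neg_neg, div_eq_mul_inv, Real.rpow_two]
  have hint : IntervalIntegrable (fun t : ℝ => 2 * t * (1 - t ^ 2) ^ (-2 : ℝ)) volume 0 b :=
    ContinuousOn.intervalIntegrable (ContinuousOn.mul (by fun_prop)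
      (ContinuousOn.rpow_const (by fun_prop) fun t ht => Or.inl (hpos t ht).ne'))
  exact ⟨hint, by rw [intervalIntegral.integral_eq_sub_of_hasDerivAt hderiv hint]; norm_num⟩

lemma norm_integral_one_sub_sq_cpow_mul_exp_le_of_lt_one {a : ℂ} (ha : -1 < a.re)
    {θ b : ℝ} (hθ : θ ≠ 0) (hb0 : 0 ≤ b) (hb1 : b < 1) :
    ‖∫ t in (0 : ℝ)..b, ((1 - t ^ 2 : ℝ) : ℂ) ^ a * Complex.exp (I * ((θ * t : ℝ) : ℂ))‖ ≤
      (‖a‖ + 2) / (|θ| * (1 - b)) := by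
  have hmem : ∀ t ∈ Set.uIcc 0 b, 0 ≤ t ∧ t < 1 := fun t ht => by
    rw [Set.uIcc_of_le hb0] at ht
    exact ⟨ht.1, ht.2.trans_lt hb1⟩
  have hderiv : ∀ c : ℂ, ∀ t ∈ Set.uIcc 0 b, HasDerivAt (fun t : ℝ => ((1 - t ^ 2 : ℝ) : ℂ) ^ c)
      (c * ((1 - t ^ 2 : ℝ) : ℂ) ^ (c - 1) * ((-(2 * t) : ℝ) : ℂ)) t := fun c t ht =>
    hasDerivAt_one_sub_sq_cpow c (hmem t ht).1 (hmem t ht).2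
  have hcont : ContinuousOn (fun t : ℝ => ((1 - t ^ 2 : ℝ) : ℂ) ^ (a - 1)) (Set.uIcc 0 b) :=
    fun t ht => (hderiv _ t ht).continuousAt.continuousWithinAt
  have hderiv_le : ∀ t ∈ Set.Ioc 0 b,
      ‖a * ((1 - t ^ 2 : ℝ) : ℂ) ^ (a - 1) * ((-(2 * t) : ℝ) : ℂ)‖ ≤
        ‖a‖ * (2 * t * (1 - t ^ 2) ^ (-2 : ℝ)) := fun t ht => by
    have hpow : ‖((1 - t ^ 2 : ℝ) : ℂ) ^ (a - 1)‖ ≤ (1 - t ^ 2) ^ (-2 : ℝ) :=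
      norm_one_sub_sq_cpow_le (by rw [Complex.sub_re, Complex.one_re]; linarith) ht.1.le
        (ht.2.trans_lt hb1)
    have htwo : ‖((-(2 * t) : ℝ) : ℂ)‖ = 2 * t := by
      rw [Complex.norm_real, norm_neg, Real.norm_of_nonneg (by linarith [ht.1])]
    have ht0 : 0 ≤ t := ht.1.le
    rw [norm_mul, norm_mul, htwo]
    calc ‖a‖ * ‖((1 - t ^ 2 : ℝ) : ℂ) ^ (a - 1)‖ * (2 * t)
        ≤ ‖a‖ * (1 - t ^ 2) ^ (-2 : ℝ) * (2 * t) := by gcongr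
      _ = ‖a‖ * (2 * t * (1 - t ^ 2) ^ (-2 : ℝ)) := by ring
  obtain ⟨hint, hval⟩ := integral_two_mul_mul_inv_one_sub_sq_sq hb0 hb1
  have hinv : (1 - b ^ 2)⁻¹ ≤ (1 - b)⁻¹ := inv_anti₀ (by linarith) (by nlinarith)
  have hone : 1 ≤ (1 - b)⁻¹ := (one_le_inv₀ (by linarith)).2 (by linarith)
  have hendpoint : ‖((1 - b ^ 2 : ℝ) : ℂ) ^ a‖ ≤ (1 - b)⁻¹ :=
    (norm_one_sub_sq_cpow_le ha.le hb0 hb1).trans (by rwa [Real.rpow_neg_one])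
  refine (norm_integral_mul_exp_I_le_of_hasDerivAt hb0 hθ (hderiv a)
    (((hcont.const_mul a).mul (by fun_prop)).intervalIntegrable) (hint.const_mul ‖a‖)
    hderiv_le).trans ?_
  rw [intervalIntegral.integral_const_mul, hval, div_mul_eq_div_div_swap, div_eq_mul_inv _ (1 - b)]
  gcongr
  have hzero : ‖((1 - (0 : ℝ) ^ 2 : ℝ) : ℂ) ^ a‖ = 1 := by simp
  rw [hzero]
  nlinarith [norm_nonneg a]

lemma integral_one_sub_sq_cpow_mul_two_mul {a : ℂ} (ha : -1 < a.re) {b : ℝ} (hb0 : 0 ≤ b)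
    (hb1 : b ≤ 1) {v v' : ℝ → ℂ} (hv : ∀ t ∈ Set.uIcc b 1, HasDerivAt v (v' t) t)
    (hv' : IntervalIntegrable v' volume b 1) :
    (a + 1) * ∫ t in b..1, ((1 - t ^ 2 : ℝ) : ℂ) ^ a * ((2 * t : ℝ) * v t) =
      ((1 - b ^ 2 : ℝ) : ℂ) ^ (a + 1) * v b +
        ∫ t in b..1, ((1 - t ^ 2 : ℝ) : ℂ) ^ (a + 1) * v' t := by
  have ha1 : 0 < (a + 1).re := by rw [Complex.add_re, Complex.one_re]; linarith
  have hcont : Continuous fun t : ℝ => ((1 - t ^ 2 : ℝ) : ℂ) ^ (a + 1) :=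
    (Complex.continuous_ofReal_cpow_const ha1).comp (by fun_prop)
  have hparts := intervalIntegral.integral_mul_deriv_eq_deriv_mul_of_hasDerivAt
    (u' := fun t => (a + 1) * ((1 - t ^ 2 : ℝ) : ℂ) ^ (a + 1 - 1) * ((-(2 * t) : ℝ) : ℂ))
    hcont.continuousOn (fun t ht => (hv t ht).continuousAt.continuousWithinAt)
    (fun t ht => by
      rw [min_eq_left hb1, max_eq_right hb1] at ht
      exact hasDerivAt_one_sub_sq_cpow (a + 1) (hb0.trans ht.1.le) ht.2)
    (fun t ht => hv t (Set.Ioo_subset_Icc_self ht))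
    (by
      rw [add_sub_cancel_right]
      exact ((intervalIntegrable_one_sub_sq_cpow ha hb0 hb1 le_rfl).const_mul
        (a + 1)).mul_continuousOn (by fun_prop)) hv'
  have hone : ((1 - (1 : ℝ) ^ 2 : ℝ) : ℂ) ^ (a + 1) = 0 := by
    simp [Complex.zero_cpow (Complex.ne_zero_of_re_pos ha1)]
  have hneg : (a + 1) * ∫ t in b..1, ((1 - t ^ 2 : ℝ) : ℂ) ^ a * ((2 * t : ℝ) * v t) =
      -∫ t in b..1, (a + 1) * ((1 - t ^ 2 : ℝ) : ℂ) ^ (a + 1 - 1) *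
        ((-(2 * t) : ℝ) : ℂ) * v t := by
    rw [← intervalIntegral.integral_const_mul, ← intervalIntegral.integral_neg,
      add_sub_cancel_right]
    congr 1 with t
    push_cast
    ring
  rw [hneg, hparts, hone]
  ring

lemma norm_one_sub_sq_cpow_le_one {a : ℂ} (ha : 0 < a.re) {t : ℝ} (h0 : 0 ≤ t) (h1 : t ≤ 1) :
    ‖((1 - t ^ 2 : ℝ) : ℂ) ^ a‖ ≤ 1 := by
  have hnonneg : 0 ≤ 1 - t ^ 2 := by nlinarith
  rw [Complex.norm_cpow_eq_rpow_re_of_nonneg hnonneg ha.ne']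
  exact Real.rpow_le_one hnonneg (by nlinarith) ha.le

lemma norm_integral_one_sub_sq_cpow_mul_two_mul_le {a : ℂ} (ha : -1 < a.re) {b : ℝ} (hb0 : 0 ≤ b)
    (hb1 : b ≤ 1) {v v' : ℝ → ℂ} {M : ℝ} (hv : ∀ t ∈ Set.uIcc b 1, HasDerivAt v (v' t) t)
    (hv' : IntervalIntegrable v' volume b 1) (hM : ∀ t ∈ Set.uIcc b 1, ‖v' t‖ ≤ M) :
    ‖(a + 1) * ∫ t in b..1, ((1 - t ^ 2 : ℝ) : ℂ) ^ a * ((2 * t : ℝ) * v t)‖ ≤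
      ‖v b‖ + M * (1 - b) := by
  have ha1 : 0 < (a + 1).re := by rw [Complex.add_re, Complex.one_re]; linarith
  rw [integral_one_sub_sq_cpow_mul_two_mul ha hb0 hb1 hv hv', ← abs_of_nonneg (sub_nonneg.2 hb1)]
  refine (norm_add_le _ _).trans (add_le_add ?_
    (intervalIntegral.norm_integral_le_of_norm_le_const fun t ht => ?_))
  · rw [norm_mul]
    exact mul_le_of_le_one_left (norm_nonneg _) (norm_one_sub_sq_cpow_le_one ha1 hb0 hb1)
  · have ht' := Set.uIoc_subset_uIcc ht
    rw [norm_mul]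
    refine (mul_le_of_le_one_left (norm_nonneg _) ?_).trans (hM t ht')
    rw [Set.uIcc_of_le hb1] at ht'
    exact norm_one_sub_sq_cpow_le_one ha1 (hb0.trans ht'.1) ht'.2

lemma norm_integral_one_sub_sq_cpow_mul_exp_le_of_half_le {a : ℂ} (ha : -1 < a.re)
    (θ : ℝ) {b : ℝ} (hb0 : 1 / 2 ≤ b) (hb1 : b < 1) :
    ‖(a + 1) * ∫ t in b..1, ((1 - t ^ 2 : ℝ) : ℂ) ^ a *
      Complex.exp (I * ((θ * t : ℝ) : ℂ))‖ ≤ 2 + |θ| * (1 - b) := by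
  have hmem : ∀ t ∈ Set.uIcc b 1, 1 ≤ 2 * t := fun t ht => by
    rw [Set.uIcc_of_le hb1.le] at ht
    linarith [ht.1]
  have hne : ∀ t ∈ Set.uIcc b 1, ((2 * t : ℝ) : ℂ) ≠ 0 := fun t ht =>
    Complex.ofReal_ne_zero.2 (by linarith [hmem t ht])
  set e : ℝ → ℂ := fun t => Complex.exp (I * ((θ * t : ℝ) : ℂ))
  have henorm : ∀ t, ‖e t‖ = 1 := fun t => norm_exp_I_mul_ofReal _
  set v' : ℝ → ℂ := fun t => (e t * (I * θ) * ((2 * t : ℝ) : ℂ) - e t * ((2 : ℝ) : ℂ)) /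
    ((2 * t : ℝ) : ℂ) ^ 2
  have hv : ∀ t ∈ Set.uIcc b 1, HasDerivAt (fun t => e t / ((2 * t : ℝ) : ℂ)) (v' t) t :=
    fun t ht =>
      (hasDerivAt_exp_I_mul θ t).div (hasDerivAt_const_mul (2 : ℝ)).ofReal_comp (hne t ht)
  have hv' : IntervalIntegrable v' volume b 1 :=
    (ContinuousOn.div (by fun_prop) (by fun_prop) fun t ht =>
      pow_ne_zero 2 (hne t ht)).intervalIntegrable
  have hvb : ‖e b / ((2 * b : ℝ) : ℂ)‖ ≤ 1 := by
    rw [norm_div, henorm, Complex.norm_real, Real.norm_of_nonneg (by linarith)]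
    exact div_le_one_of_le₀ (by linarith) (by linarith)
  have hM : ∀ t ∈ Set.uIcc b 1, ‖v' t‖ ≤ |θ| + 2 := fun t ht => by
    have htwo := hmem t ht
    have hnum : ‖e t * (I * θ) * ((2 * t : ℝ) : ℂ) - e t * ((2 : ℝ) : ℂ)‖ ≤ |θ| * (2 * t) + 2 := by
      refine (norm_sub_le _ _).trans (le_of_eq ?_)
      rw [norm_mul, norm_mul, norm_mul, norm_mul, henorm, Complex.norm_I, one_mul, one_mul, one_mul,
        Complex.norm_real, Complex.norm_real, Complex.norm_real, Real.norm_eq_abs θ,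
        Real.norm_of_nonneg (by linarith), Real.norm_of_nonneg zero_le_two]
    rw [norm_div, norm_pow, Complex.norm_real, Real.norm_of_nonneg (by linarith),
      div_le_iff₀ (by positivity)]
    nlinarith [abs_nonneg θ, mul_nonneg (abs_nonneg θ) (by nlinarith : 0 ≤ 2 * t * (2 * t - 1))]
  have hcongr : ∫ t in b..1, ((1 - t ^ 2 : ℝ) : ℂ) ^ a * e t =
      ∫ t in b..1, ((1 - t ^ 2 : ℝ) : ℂ) ^ a * ((2 * t : ℝ) * (e t / ((2 * t : ℝ) : ℂ))) :=
    intervalIntegral.integral_congr fun t ht => by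
      simp only [mul_div_cancel₀ _ (hne t ht)]
  rw [hcongr]
  refine (norm_integral_one_sub_sq_cpow_mul_two_mul_le ha (by linarith) hb1.le hv hv' hM).trans ?_
  nlinarith

lemma norm_integral_zero_half_one_sub_sq_cpow_mul_exp_le {a : ℂ} (ha : -1 < a.re) (θ : ℝ) :
    ‖∫ t in (0 : ℝ)..(1 / 2), ((1 - t ^ 2 : ℝ) : ℂ) ^ a *
      Complex.exp (I * ((θ * t : ℝ) : ℂ))‖ ≤ 1 := by
  have hle : ∀ t ∈ Set.uIoc (0 : ℝ) (1 / 2),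
      ‖((1 - t ^ 2 : ℝ) : ℂ) ^ a * Complex.exp (I * ((θ * t : ℝ) : ℂ))‖ ≤ 2 := fun t ht => by
    rw [Set.uIoc_of_le (by norm_num)] at ht
    rw [norm_mul, norm_exp_I_mul_ofReal, mul_one]
    refine (norm_one_sub_sq_cpow_le ha.le ht.1.le (by linarith [ht.2])).trans ?_
    rw [Real.rpow_neg_one]
    exact inv_le_of_inv_le₀ (by norm_num) (by nlinarith [ht.1, ht.2])
  refine (intervalIntegral.norm_integral_le_of_norm_le_const hle).trans (le_of_eq ?_)
  norm_num

lemma norm_add_one_mul_integral_one_sub_sq_cpow_mul_exp_le {a : ℂ} (ha : -1 < a.re) (θ : ℝ) :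
    ‖(a + 1) * ∫ t in (0 : ℝ)..1, ((1 - t ^ 2 : ℝ) : ℂ) ^ a *
      Complex.exp (I * ((θ * t : ℝ) : ℂ))‖ ≤ 4 * (‖a‖ + 2) := by
  set T : ℝ := ‖a‖ + 2
  have hT : 2 ≤ T := le_add_of_nonneg_left (norm_nonneg a)
  have haT : ‖a + 1‖ ≤ T := (norm_add_le a 1).trans (by rw [norm_one]; linarith)
  have hint : ∀ b c : ℝ, 0 ≤ b → b ≤ c → c ≤ 1 → IntervalIntegrable (fun t : ℝ =>
      ((1 - t ^ 2 : ℝ) : ℂ) ^ a * Complex.exp (I * ((θ * t : ℝ) : ℂ))) volume b c :=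
    fun b c hb hbc hc => (intervalIntegrable_one_sub_sq_cpow ha hb hbc hc).mul_continuousOn
      (by fun_prop)
  have hsplit : ∀ b : ℝ, 1 / 2 ≤ b → b < 1 → ‖(a + 1) * ∫ t in (0 : ℝ)..1,
      ((1 - t ^ 2 : ℝ) : ℂ) ^ a * Complex.exp (I * ((θ * t : ℝ) : ℂ))‖ ≤
      T * ‖∫ t in (0 : ℝ)..b, ((1 - t ^ 2 : ℝ) : ℂ) ^ a *
        Complex.exp (I * ((θ * t : ℝ) : ℂ))‖ + (2 + |θ| * (1 - b)) := fun b hb0 hb1 => by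
    rw [← intervalIntegral.integral_add_adjacent_intervals (hint 0 b le_rfl (by linarith) hb1.le)
      (hint b 1 (by linarith) hb1.le le_rfl), mul_add]
    refine (norm_add_le _ _).trans (add_le_add ?_
      (norm_integral_one_sub_sq_cpow_mul_exp_le_of_half_le ha θ hb0 hb1))
    rw [norm_mul]
    gcongr
  rcases le_or_gt |θ| (2 * T) with hθ | hθ
  · refine (hsplit (1 / 2) le_rfl (by norm_num)).trans ?_
    have hhalf := norm_integral_zero_half_one_sub_sq_cpow_mul_exp_le ha θ
    nlinarith
  · have hθ0 : 0 < |θ| := by linarith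
    have hb : T / |θ| < 1 / 2 := by rw [div_lt_iff₀ hθ0]; linarith
    have hb' : 0 < T / |θ| := by positivity
    have hfar := norm_integral_one_sub_sq_cpow_mul_exp_le_of_lt_one ha (b := 1 - T / |θ|)
      (abs_pos.1 hθ0) (by linarith) (by linarith)
    refine (hsplit (1 - T / |θ|) (by linarith) (by linarith)).trans ?_
    rw [sub_sub_cancel, mul_div_cancel₀ _ hθ0.ne'] at hfar ⊢
    rw [div_self (by positivity : T ≠ 0)] at hfar
    nlinarith

lemma integral_Ioi_ballProfile_mul_exp (a : ℂ) (θ : ℝ) :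
    ∫ t in Set.Ioi (0 : ℝ), ballProfile a t * Complex.exp (I * ((θ * t : ℝ) : ℂ)) =
      ∫ t in (0 : ℝ)..1, ((1 - t ^ 2 : ℝ) : ℂ) ^ a * Complex.exp (I * ((θ * t : ℝ) : ℂ)) := by
  rw [intervalIntegral.integral_of_le zero_le_one, integral_Ioc_eq_integral_Ioo,
    ← integral_indicator measurableSet_Ioo, ← integral_indicator measurableSet_Ioi]
  congr 1 with t
  by_cases h0 : 0 < t <;> by_cases h1 : t < 1 <;> simp [Set.indicator, ballProfile, h0, h1]

lemma integral_ballProfile_real_mul_exp {a : ℂ} (ha : -1 < a.re) (r : ℝ) :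
    ∫ ξ : ℝ, ballProfile a ‖ξ‖ * Complex.exp (I * ((inner ℝ r ξ : ℝ) : ℂ)) =
      (∫ t in (0 : ℝ)..1, ((1 - t ^ 2 : ℝ) : ℂ) ^ a * Complex.exp (I * ((-r * t : ℝ) : ℂ))) +
        ∫ t in (0 : ℝ)..1, ((1 - t ^ 2 : ℝ) : ℂ) ^ a * Complex.exp (I * ((r * t : ℝ) : ℂ)) := by
  have hint : Integrable fun ξ : ℝ =>
      ballProfile a ‖ξ‖ * Complex.exp (I * ((inner ℝ r ξ : ℝ) : ℂ)) :=
    (integrable_ballProfile_norm volume ha).mul_bdd (c := 1)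
      (Continuous.aestronglyMeasurable (by fun_prop))
      (Eventually.of_forall fun t => (norm_exp_I_mul_ofReal _).le)
  rw [← integral_add_compl (measurableSet_Iic (a := 0)) hint, Set.compl_Iic,
    ← integral_Ioi_ballProfile_mul_exp, ← integral_Ioi_ballProfile_mul_exp]
  congr 1
  · have hreflect := integral_comp_neg_Iic (0 : ℝ)
      fun t => ballProfile a t * Complex.exp (I * ((-r * t : ℝ) : ℂ))
    rw [neg_zero] at hreflect
    rw [← hreflect]
    refine setIntegral_congr_fun measurableSet_Iic fun t ht => ?_
    simp [abs_of_nonpos (Set.mem_Iic.1 ht), mul_comm]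
  · refine setIntegral_congr_fun measurableSet_Ioi fun t ht => ?_
    simp [abs_of_pos (Set.mem_Ioi.1 ht), mul_comm]

lemma norm_Gamma_mul_besselClifford_le_of_lt {a : ℂ} (ha : -1 < a.re) {r : ℝ} (hr : 0 ≤ r) :
    ‖Gamma (a + 2) * besselClifford (a + 3 / 2) r‖ ≤ 8 * (‖a‖ + 2) := by
  have ha1 : a + 1 ≠ 0 := Complex.ne_zero_of_re_pos (by
    rw [Complex.add_re, Complex.one_re]; linarith)
  have hGamma : Gamma (a + 2) = (a + 1) * Gamma (a + 1) := by
    rw [← Complex.Gamma_add_one _ ha1, add_assoc, one_add_one_eq_two]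
  have hfourier := integral_ballProfile_mul_exp ha r
  rw [integral_ballProfile_real_mul_exp ha, Module.finrank_self, Real.norm_of_nonneg hr,
    Nat.cast_one, show a + 1 / 2 + 1 = a + 3 / 2 by ring] at hfourier
  have hpi : 1 ≤ ‖(π : ℂ) ^ ((1 : ℂ) / 2)‖ := by
    rw [Complex.norm_cpow_eq_rpow_re_of_pos Real.pi_pos]
    exact Real.one_le_rpow (by linarith [Real.pi_gt_three]) (by norm_num)
  calc ‖Gamma (a + 2) * besselClifford (a + 3 / 2) r‖
      ≤ ‖(π : ℂ) ^ ((1 : ℂ) / 2)‖ * ‖Gamma (a + 2) * besselClifford (a + 3 / 2) r‖ :=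
        le_mul_of_one_le_left (norm_nonneg _) hpi
    _ = ‖(a + 1) * (Gamma (a + 1) * (π : ℂ) ^ ((1 : ℂ) / 2) * besselClifford (a + 3 / 2) r)‖ := by
        rw [← norm_mul, hGamma]
        ring_nf
    _ ≤ 4 * (‖a‖ + 2) + 4 * (‖a‖ + 2) := by
        rw [← hfourier, mul_add]
        exact (norm_add_le _ _).trans (add_le_add
          (norm_add_one_mul_integral_one_sub_sq_cpow_mul_exp_le ha _)
          (norm_add_one_mul_integral_one_sub_sq_cpow_mul_exp_le ha _))
    _ = 8 * (‖a‖ + 2) := by ring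

lemma differentiableAt_Gamma_of_re_pos {s : ℂ} (hs : 0 < s.re) : DifferentiableAt ℂ Gamma s :=
  Complex.differentiableAt_Gamma s fun m hm => by
    rw [hm, Complex.neg_re, Complex.natCast_re] at hs
    linarith [(Nat.cast_nonneg m : (0 : ℝ) ≤ m)]

lemma norm_Gamma_mul_besselClifford_le {a : ℂ} (ha : -1 ≤ a.re) {r : ℝ} (hr : 0 ≤ r) :
    ‖Gamma (a + 2) * besselClifford (a + 3 / 2) r‖ ≤ 8 * (‖a‖ + 2) := by
  have hclosure : a ∈ closure {w : ℂ | -1 < w.re} := by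
    rwa [Complex.closure_setOfPred_lt_re]
  have hGamma : ContinuousAt (fun w : ℂ => Gamma (w + 2)) a :=
    ((differentiableAt_Gamma_of_re_pos (by
      rw [Complex.add_re, Complex.re_ofNat]; linarith)).continuousAt).comp
      (f := fun w : ℂ => w + 2) (by fun_prop)
  have hbessel : ContinuousAt (fun w : ℂ => besselClifford (w + 3 / 2) r) a :=
    ((differentiable_besselClifford r).continuous.comp (by fun_prop)).continuousAt
  exact ContinuousWithinAt.closure_le hclosure (hGamma.mul hbessel).norm.continuousWithinAt
    (by fun_prop) fun w hw => norm_Gamma_mul_besselClifford_le_of_lt hw hr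

end Oscillatory

section GammaWeight

lemma exists_norm_Gamma_le_norm_Gamma_add {x δ : ℝ} (hx : 0 < x) (hδ : 0 ≤ δ) :
    ∃ C : ℝ, 0 ≤ C ∧ ∀ b : ℂ, x ≤ b.re → ‖Gamma b‖ ≤ C * ‖Gamma (b + δ)‖ := by
  rcases hδ.eq_or_lt with rfl | hδ
  · exact ⟨1, zero_le_one, fun b _ => by rw [Complex.ofReal_zero, add_zero, one_mul]⟩
  have hconv := (Complex.betaIntegral_convergent (u := x) (v := δ) (by simpa) (by simpa)).norm
  have hΓ : 0 < ‖Gamma δ‖ := norm_pos_iff.2 (Complex.Gamma_ne_zero_of_re_pos (by simpa))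
  set M : ℝ := ∫ t in (0 : ℝ)..1, ‖(t : ℂ) ^ ((x : ℂ) - 1) * (1 - (t : ℂ)) ^ ((δ : ℂ) - 1)‖
  have hM : 0 ≤ M := intervalIntegral.integral_nonneg zero_le_one fun t _ => norm_nonneg _
  refine ⟨M / ‖Gamma δ‖, by positivity, fun b hb => ?_⟩
  have hbeta : ‖Complex.betaIntegral b δ‖ ≤ M := by
    refine intervalIntegral.norm_integral_le_of_norm_le zero_le_one
      (Eventually.of_forall fun t ht => ?_) hconv
    rw [norm_mul, norm_mul, Complex.norm_cpow_eq_rpow_re_of_pos ht.1,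
      Complex.norm_cpow_eq_rpow_re_of_pos ht.1]
    exact mul_le_mul_of_nonneg_right
      (Real.rpow_le_rpow_of_exponent_ge ht.1 ht.2 (by simpa using hb)) (norm_nonneg _)
  have hGamma : ‖Gamma b‖ * ‖Gamma δ‖ = ‖Gamma (b + δ)‖ * ‖Complex.betaIntegral b δ‖ := by
    rw [← norm_mul, ← norm_mul,
      Complex.Gamma_mul_Gamma_eq_betaIntegral (hx.trans_le hb) (by simpa)]
  rw [div_mul_eq_mul_div, le_div_iff₀ hΓ, hGamma, mul_comm]
  gcongr

lemma norm_Gamma_add_natCast_add_one_le {z : ℂ} (hz : 0 ≤ z.re) (k : ℕ) {j : ℕ} (hj : j ≤ k) :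
    ‖Gamma (z + j + 1)‖ ≤ ‖Gamma (z + 1)‖ * ‖z + k‖ ^ j := by
  induction j with
  | zero => simp
  | succ j ih =>
    have hne : z + j + 1 ≠ 0 := Complex.ne_zero_of_re_pos (by
      rw [Complex.add_re, Complex.add_re, Complex.natCast_re, Complex.one_re]; positivity)
    have hle : ‖z + j + 1‖ ≤ ‖z + k‖ := by
      have hjk : (j : ℝ) + 1 ≤ k := by exact_mod_cast hj
      rw [Complex.norm_def, Complex.norm_def]
      refine Real.sqrt_le_sqrt ?_
      simp only [Complex.normSq_apply, Complex.add_re, Complex.add_im, Complex.natCast_re,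
        Complex.natCast_im, Complex.one_re, Complex.one_im]
      nlinarith
    rw [Nat.cast_succ, ← add_assoc, Complex.Gamma_add_one _ hne, norm_mul, pow_succ, ← mul_assoc,
      mul_comm]
    exact mul_le_mul (ih (by omega)) hle (norm_nonneg _) (by positivity)

lemma exists_one_add_abs_im_le_norm {x : ℝ} (hx : x ≠ 0) :
    ∃ d : ℝ, 0 < d ∧ ∀ w : ℂ, w.re = x → d * (1 + |w.im|) ≤ ‖w‖ := by
  have hx0 : 0 < |x| := abs_pos.2 hx
  refine ⟨|x| / (1 + |x|), by positivity, fun w hw => ?_⟩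
  have hre : |x| ≤ ‖w‖ := hw ▸ Complex.abs_re_le_norm w
  have him := Complex.abs_im_le_norm w
  rw [div_mul_eq_mul_div, div_le_iff₀ (by positivity)]
  nlinarith

lemma exists_norm_Gamma_mul_pow_le_norm_Gamma_add {x : ℝ} (m : ℕ) (hx : ∀ j < m, x + j ≠ 0) :
    ∃ d : ℝ, 0 < d ∧ ∀ w : ℂ, w.re = x →
      d * (1 + |w.im|) ^ m * ‖Gamma w‖ ≤ ‖Gamma (w + m)‖ := by
  induction m with
  | zero => exact ⟨1, one_pos, fun w _ => by simp⟩
  | succ m ih =>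
    obtain ⟨d, hd0, hd⟩ := ih fun j hj => hx j (by omega)
    obtain ⟨e, he0, he⟩ := exists_one_add_abs_im_le_norm (hx m (by omega))
    refine ⟨d * e, by positivity, fun w hw => ?_⟩
    have hwm : e * (1 + |w.im|) ≤ ‖w + m‖ := by
      simpa using he (w + m) (by rw [Complex.add_re, Complex.natCast_re, hw])
    have hne : w + m ≠ 0 := norm_pos_iff.1 (lt_of_lt_of_le (by positivity) hwm)
    rw [Nat.cast_succ, ← add_assoc, Complex.Gamma_add_one _ hne, norm_mul]
    calc d * e * (1 + |w.im|) ^ (m + 1) * ‖Gamma w‖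
        = e * (1 + |w.im|) * (d * (1 + |w.im|) ^ m * ‖Gamma w‖) := by ring
      _ ≤ ‖w + m‖ * ‖Gamma (w + m)‖ := by
        gcongr
        exact hd w hw

lemma norm_add_ofReal_le {z : ℂ} {b : ℝ} (h : 1 ≤ ‖z + b‖) (a : ℝ) :
    ‖z + a‖ ≤ (1 + |a - b|) * ‖z + b‖ := by
  have htri : ‖z + a‖ ≤ ‖z + b‖ + |a - b| := by
    have := norm_add_le (z + b) ((a - b : ℝ) : ℂ)
    rwa [Complex.norm_real, Real.norm_eq_abs, Complex.ofReal_sub, add_add_sub_cancel] at this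
  nlinarith [abs_nonneg (a - b)]

/-- The number of poles removed from `Γ(z+1)` in `interpolationWeight`: the least `m` for which
`Γ(z+m)` has no pole in the half-plane `Re z ≥ -(n+1)/2`. -/
def poleCount (n : ℕ) : ℕ := (n + 1) / 2 + 1

/-- The weight `Γ(z+m+1) / (z+n+2)^m`, `m = poleCount n`, by which the analytic family of operators
is multiplied before interpolation. It is as large as `Γ(z+1)` at infinity, but it is holomorphic
and has no zeros in the strip `-(n+1)/2 ≤ Re z ≤ 0`. -/
def interpolationWeight (n : ℕ) (z : ℂ) : ℂ :=
  Gamma (z + poleCount n + 1) / (z + (n + 2)) ^ poleCount n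

lemma le_poleCount (n : ℕ) : ((n : ℝ) + 2) / 2 ≤ poleCount n := by
  have h : n + 2 ≤ 2 * poleCount n := by unfold poleCount; omega
  rify at h
  linarith

lemma poleCount_le (n : ℕ) : (poleCount n : ℝ) ≤ ((n : ℝ) + 3) / 2 := by
  have h : 2 * poleCount n ≤ n + 3 := by unfold poleCount; omega
  rify at h
  linarith

lemma two_le_poleCount {n : ℕ} (hn : 1 ≤ n) : 2 ≤ poleCount n := by
  unfold poleCount
  omega

section HalfPlane

variable {n : ℕ} {z : ℂ}

lemma re_add_poleCount_pos (hz : -(((n : ℝ) + 1) / 2) ≤ z.re) : 0 < (z + poleCount n).re := by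
  rw [Complex.add_re, Complex.natCast_re]
  linarith [le_poleCount n]

lemma re_add_poleCount_add_one_pos (hz : -(((n : ℝ) + 1) / 2) ≤ z.re) :
    0 < (z + poleCount n + 1).re := by
  rw [Complex.add_re, Complex.one_re]
  linarith [re_add_poleCount_pos hz]

lemma one_le_re_add_natCast_add_two (hz : -(((n : ℝ) + 1) / 2) ≤ z.re) : 1 ≤ (z + (n + 2)).re := by
  simp only [Complex.add_re, Complex.natCast_re, Complex.re_ofNat]
  linarith [(n.cast_nonneg : (0 : ℝ) ≤ n)]

lemma add_natCast_add_two_ne_zero (hz : -(((n : ℝ) + 1) / 2) ≤ z.re) : z + (n + 2) ≠ 0 :=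
  Complex.ne_zero_of_re_pos (one_pos.trans_le (one_le_re_add_natCast_add_two hz))

lemma differentiableAt_interpolationWeight (hz : -(((n : ℝ) + 1) / 2) ≤ z.re) :
    DifferentiableAt ℂ (interpolationWeight n) z :=
  ((differentiableAt_Gamma_of_re_pos (re_add_poleCount_add_one_pos hz)).comp
    (f := fun z : ℂ => z + poleCount n + 1) z (by fun_prop)).div (by fun_prop)
      (pow_ne_zero _ (add_natCast_add_two_ne_zero hz))

lemma interpolationWeight_ne_zero (hz : -(((n : ℝ) + 1) / 2) ≤ z.re) :
    interpolationWeight n z ≠ 0 :=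
  div_ne_zero (Complex.Gamma_ne_zero_of_re_pos (re_add_poleCount_add_one_pos hz))
    (pow_ne_zero _ (add_natCast_add_two_ne_zero hz))

end HalfPlane

lemma norm_Gamma_mul_besselClifford_add_half_le {n : ℕ} {z : ℂ}
    (hz : -(((n : ℝ) + 1) / 2) ≤ z.re) {r : ℝ} (hr : 0 ≤ r) :
    ‖Gamma (z + ((n + 3) / 2 : ℝ))‖ * ‖besselClifford (z + n / 2 + 1) r‖ ≤
      8 * (‖z + ((n - 1) / 2 : ℝ)‖ + 2) := by
  have h := norm_Gamma_mul_besselClifford_le (a := z + ((n - 1) / 2 : ℝ)) (by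
    rw [Complex.add_re, Complex.ofReal_re]; linarith) hr
  rw [norm_mul] at h
  convert h using 4 <;> push_cast <;> ring

lemma exists_norm_interpolationWeight_mul_besselClifford_le {n : ℕ} (hn : 1 ≤ n) :
    ∃ C : ℝ, 0 ≤ C ∧ ∀ z : ℂ, -(((n : ℝ) + 1) / 2) ≤ z.re → ∀ r : ℝ, 0 ≤ r →
      ‖interpolationWeight n z * besselClifford (z + n / 2 + 1) r‖ ≤ C := by
  obtain ⟨C, hC0, hC⟩ := exists_norm_Gamma_le_norm_Gamma_add (x := 1 / 2)
    (δ := ((n : ℝ) + 3) / 2 - poleCount n) (by norm_num) (by linarith [poleCount_le n])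
  set K : ℝ := 1 + |(poleCount n : ℝ) - (n + 2)|
  set L : ℝ := 1 + |((n : ℝ) - 1) / 2 - (n + 2)| + 2
  refine ⟨K * C * (8 * L), by positivity, fun z hz r hr => ?_⟩
  set W : ℝ := ‖z + (n + 2)‖ with hWdef
  have hW : 1 ≤ W := (one_le_re_add_natCast_add_two hz).trans (Complex.re_le_norm _)
  have hW' : ‖z + ((n + 2 : ℝ) : ℂ)‖ = W := by rw [hWdef]; push_cast; rfl
  have hadd : ∀ a : ℝ, ‖z + a‖ ≤ (1 + |a - (n + 2)|) * W := fun a =>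
    (norm_add_ofReal_le (by rwa [hW']) a).trans_eq (by rw [hW'])
  have hK : ‖z + poleCount n‖ ≤ K * W := by simpa using hadd (poleCount n)
  have hΓ : ‖Gamma (z + poleCount n)‖ ≤ C * ‖Gamma (z + ((n + 3) / 2 : ℝ))‖ := by
    refine (hC (z + poleCount n) ?_).trans (le_of_eq ?_)
    · rw [Complex.add_re, Complex.natCast_re]
      linarith [le_poleCount n]
    · rw [Complex.ofReal_sub, Complex.ofReal_natCast, add_add_sub_cancel]
  have hbessel := norm_Gamma_mul_besselClifford_add_half_le hz hr
  have hL : 8 * (‖z + ((n - 1) / 2 : ℝ)‖ + 2) ≤ 8 * (L * W) := by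
    have := hadd ((n - 1) / 2)
    simp only [L]
    linarith
  have hm : z + poleCount n ≠ 0 := Complex.ne_zero_of_re_pos (re_add_poleCount_pos hz)
  rw [interpolationWeight, Complex.Gamma_add_one _ hm, norm_mul, norm_div, norm_mul, norm_pow,
    div_mul_eq_mul_div, div_le_iff₀ (by positivity)]
  set J : ℝ := ‖besselClifford (z + n / 2 + 1) r‖
  calc ‖z + poleCount n‖ * ‖Gamma (z + poleCount n)‖ * J
      ≤ K * W * (C * ‖Gamma (z + ((n + 3) / 2 : ℝ))‖) * J := by gcongr
    _ = K * W * C * (‖Gamma (z + ((n + 3) / 2 : ℝ))‖ * J) := by ring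
    _ ≤ K * W * C * (8 * (L * W)) :=
        mul_le_mul_of_nonneg_left (hbessel.trans hL) (by positivity)
    _ = K * C * (8 * L) * W ^ 2 := by ring
    _ ≤ K * C * (8 * L) * W ^ poleCount n := by
        gcongr
        exact two_le_poleCount hn

lemma norm_interpolationWeight_le (n : ℕ) {z : ℂ} (hz : 0 ≤ z.re) :
    ‖interpolationWeight n z‖ ≤ ‖Gamma (z + 1)‖ := by
  have hne : z + (n + 2) ≠ 0 := add_natCast_add_two_ne_zero (le_trans (by
    linarith [(n.cast_nonneg : (0 : ℝ) ≤ n)]) hz)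
  have h := norm_Gamma_add_natCast_add_one_le hz (n + 2) (j := poleCount n)
    (by unfold poleCount; omega)
  rw [interpolationWeight, norm_div, norm_pow, div_le_iff₀ (by positivity)]
  rwa [Nat.cast_add, Nat.cast_ofNat] at h

lemma bochnerRieszFactor_eq {z : ℂ} (hz : z + 1 ≠ 0) :
    bochnerRieszFactor z = Gamma (z + 3) / (z + 1) := by
  unfold bochnerRieszFactor
  split_ifs with h
  · rw [h, show (-2 + 3 : ℂ) = 1 by norm_num, Complex.Gamma_one]
    norm_num
  · have hz2 : z + 1 + 1 ≠ 0 := fun h' => h (by linear_combination h')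
    rw [show z + 3 = z + 1 + 1 + 1 by ring, Complex.Gamma_add_one _ hz2,
      Complex.Gamma_add_one _ hz]
    field_simp
    ring

lemma exists_norm_bochnerRieszFactor_le {n : ℕ} (hn : 1 ≤ n) {x : ℝ}
    (hx : -(((n : ℝ) + 1) / 2) ≤ x) (hpole : ∀ k : ℕ, k ≠ 0 → k ≠ 2 → x ≠ -k) :
    ∃ C : ℝ, 0 ≤ C ∧ ∀ z : ℂ, z.re = x →
      ‖bochnerRieszFactor z‖ ≤ C * (1 + |z.im|) * ‖interpolationWeight n z‖ := by
  obtain ⟨m, hm⟩ := Nat.exists_eq_add_of_le' (two_le_poleCount hn)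
  obtain ⟨d, hd0, hd⟩ := exists_norm_Gamma_mul_pow_le_norm_Gamma_add (x := x + 3) m
    fun j _ h => hpole (j + 3) (by omega) (by omega) (by push_cast; linarith)
  obtain ⟨e, he0, he⟩ := exists_one_add_abs_im_le_norm (x := x + 1)
    fun h => hpole 1 one_ne_zero (by norm_num) (by push_cast; linarith)
  set c : ℝ := |x| + (n + 2) + 1
  refine ⟨c ^ (m + 2) / (d * e), by positivity, fun z hz => ?_⟩
  set Y : ℝ := 1 + |z.im|
  have hY : 1 ≤ Y := le_add_of_nonneg_right (abs_nonneg _)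
  have hone : e * Y ≤ ‖z + 1‖ := by
    simpa using he (z + 1) (by rw [Complex.add_re, Complex.one_re, hz])
  have hGamma : d * Y ^ m * ‖Gamma (z + 3)‖ ≤ ‖Gamma (z + poleCount n + 1)‖ := by
    have h := hd (z + 3) (by rw [Complex.add_re, Complex.re_ofNat, hz])
    rw [Complex.add_im, Complex.im_ofNat, add_zero] at h
    rwa [show z + poleCount n + 1 = z + 3 + m by rw [hm]; push_cast; ring]
  have hden : ‖z + (n + 2)‖ ≤ c * Y := by
    have hnorm : ‖(n + 2 : ℂ)‖ = n + 2 := by exact_mod_cast Complex.norm_natCast (n + 2)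
    have hz' : ‖z‖ ≤ |x| + |z.im| := hz ▸ Complex.norm_le_abs_re_add_abs_im z
    refine (norm_add_le _ _).trans ?_
    rw [hnorm]
    nlinarith [abs_nonneg x, abs_nonneg z.im]
  have hden0 : 0 < ‖z + (n + 2)‖ := norm_pos_iff.2 (add_natCast_add_two_ne_zero (hz ▸ hx))
  have hone0 : 0 < ‖z + 1‖ := lt_of_lt_of_le (by positivity) hone
  rw [bochnerRieszFactor_eq (norm_pos_iff.1 hone0), interpolationWeight, norm_div, norm_div,
    norm_pow, div_le_iff₀ hone0, hm, ← mul_div_assoc, div_mul_eq_mul_div,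
    le_div_iff₀ (by positivity)]
  calc ‖Gamma (z + 3)‖ * ‖z + (n + 2)‖ ^ (m + 2)
      ≤ ‖Gamma (z + 3)‖ * (c * Y) ^ (m + 2) := by gcongr
    _ = c ^ (m + 2) / (d * e) * Y * (d * Y ^ m * ‖Gamma (z + 3)‖) * (e * Y) := by
        rw [mul_pow, pow_add Y]
        field_simp
    _ ≤ c ^ (m + 2) / (d * e) * Y * ‖Gamma (z + poleCount n + 1)‖ * ‖z + 1‖ := by gcongr
    _ = _ := by rw [hm]

end GammaWeight

section Plancherel

variable {V : Type*} [NormedAddCommGroup V] [InnerProductSpace ℝ V] [FiniteDimensional ℝ V]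
  [MeasurableSpace V] [BorelSpace V]
  {F : Type*} [NormedAddCommGroup F]

lemma integral_fourier_smul_eq_of_integrable [NormedSpace ℂ F] [CompleteSpace F]
    {f : V → ℂ} {g : V → F} (hf : Integrable f) (hg : Integrable g) :
    ∫ ξ, 𝓕 f ξ • g ξ = ∫ x, f x • 𝓕 g x := by
  simpa using! VectorFourier.integral_fourierIntegral_smul_eq_flip (L := innerₗ V)
    Real.continuous_fourierChar continuous_inner hf hg

lemma continuous_fourier_of_integrable [NormedSpace ℂ F] {f : V → F} (hf : Integrable f) :
    Continuous (𝓕 f) :=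
  VectorFourier.fourierIntegral_continuous Real.continuous_fourierChar
    (by exact continuous_inner) hf

lemma norm_fourier_le_integral_norm [NormedSpace ℂ F] (f : V → F) (ξ : V) :
    ‖𝓕 f ξ‖ ≤ ∫ x, ‖f x‖ :=
  VectorFourier.norm_fourierIntegral_le_integral_norm _ _ _ _ _

variable [InnerProductSpace ℂ F] [CompleteSpace F]

lemma coeFn_fourier_toLp {f : V → F} (hf : Integrable f) (hf2 : MemLp f 2) :
    (𝓕 (hf2.toLp f) : Lp F 2 (volume : Measure V)) =ᵐ[volume] 𝓕 f := by
  refine ae_eq_of_integral_contDiff_smul_eq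
    ((Lp.memLp _).locallyIntegrable (by norm_num))
    (continuous_fourier_of_integrable hf).locallyIntegrable fun g hg hgs => ?_
  let φ : 𝓢(V, ℂ) := (hgs.comp_left (g := fun x : ℝ => (x : ℂ)) (by simp)).toSchwartzMap
    (Complex.ofRealCLM.contDiff.comp hg)
  have hφ : ∀ x, φ x = (g x : ℂ) := fun x => rfl
  have h := congrArg (fun T : 𝓢'(V, F) => T φ) (Lp.fourier_toTemperedDistribution_eq (hf2.toLp f))
  simp only [TemperedDistribution.fourier_apply, Lp.toTemperedDistribution_apply] at h
  calc ∫ x, g x • (𝓕 (hf2.toLp f) : Lp F 2 (volume : Measure V)) x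
      = ∫ x, φ x • (𝓕 (hf2.toLp f) : Lp F 2 (volume : Measure V)) x := by
        simp_rw [hφ, Complex.coe_smul]
    _ = ∫ x, 𝓕 (φ : V → ℂ) x • hf2.toLp f x := by rw [← h, SchwartzMap.fourier_coe]
    _ = ∫ x, 𝓕 (φ : V → ℂ) x • f x :=
        integral_congr_ae (hf2.coeFn_toLp.mono fun x hx => congrArg (_ • ·) hx)
    _ = ∫ x, φ x • 𝓕 f x := integral_fourier_smul_eq_of_integrable φ.integrable hf
    _ = ∫ x, g x • 𝓕 f x := by simp_rw [hφ, Complex.coe_smul]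

lemma memLp_two_fourier {f : V → F} (hf : Integrable f) (hf2 : MemLp f 2) : MemLp (𝓕 f) 2 :=
  (memLp_congr_ae (coeFn_fourier_toLp hf hf2)).1 (Lp.memLp _)

lemma eLpNorm_two_fourier {f : V → F} (hf : Integrable f) (hf2 : MemLp f 2) :
    eLpNorm (𝓕 f) 2 = eLpNorm f 2 := by
  rw [← eLpNorm_congr_ae (coeFn_fourier_toLp hf hf2), ← eLpNorm_congr_ae hf2.coeFn_toLp,
    ← Lp.enorm_def, ← Lp.enorm_def, ← ofReal_norm, ← ofReal_norm, Lp.norm_fourier_eq]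

lemma integral_norm_rpow_two_fourier {f : V → F} (hf : Integrable f) (hf2 : MemLp f 2) :
    ∫ ξ, ‖𝓕 f ξ‖ ^ (2 : ℝ) = ∫ x, ‖f x‖ ^ (2 : ℝ) := by
  have hpos : ∀ g : V → F, 0 ≤ ∫ x, ‖g x‖ ^ (2 : ℝ) := fun g =>
    integral_nonneg fun x => Real.rpow_nonneg (norm_nonneg _) _
  have h := eLpNorm_two_fourier hf hf2
  rw [(memLp_two_fourier hf hf2).eLpNorm_eq_integral_rpow_norm two_ne_zero ENNReal.ofNat_ne_top,
    hf2.eLpNorm_eq_integral_rpow_norm two_ne_zero ENNReal.ofNat_ne_top, ENNReal.toReal_ofNat,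
    ENNReal.ofReal_eq_ofReal_iff (Real.rpow_nonneg (hpos _) _) (Real.rpow_nonneg (hpos _) _)] at h
  exact Real.rpow_left_injOn (by norm_num) (hpos _) (hpos _) h

end Plancherel

section Kernel

variable {V : Type*} [NormedAddCommGroup V] [InnerProductSpace ℝ V]

/-- The kernel `K_z` of the analytic family `S̃ ^ z f = f * K_z` of Bochner–Riesz operators on a
Euclidean space: the entire continuation in `z` of the inverse Fourier transform of the symbol,
divided by `Γ(z + 1)`. -/
def bochnerRieszKernel (z : ℂ) (x : V) : ℂ :=
  (((2 * π) ^ finrank ℝ V : ℝ) : ℂ)⁻¹ * (π : ℂ) ^ (finrank ℝ V / 2 : ℂ) *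
    besselClifford (z + finrank ℝ V / 2 + 1) ‖x‖

lemma continuous_bochnerRieszKernel : Continuous fun p : ℂ × V => bochnerRieszKernel p.1 p.2 := by
  have h : Continuous fun p : ℂ × V => (p.1 + (finrank ℝ V : ℂ) / 2 + 1, ‖p.2‖) := by fun_prop
  have hcomp : Continuous fun p : ℂ × V =>
      besselClifford (p.1 + (finrank ℝ V : ℂ) / 2 + 1) ‖p.2‖ :=
    (continuous_besselClifford.comp h :)
  exact hcomp.const_mul _

lemma differentiable_bochnerRieszKernel (x : V) :
    Differentiable ℂ fun z : ℂ => bochnerRieszKernel z x :=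
  ((differentiable_besselClifford ‖x‖).comp
    (show Differentiable ℂ fun z : ℂ => z + finrank ℝ V / 2 + 1 by fun_prop)).const_mul _

/-- The Fourier multiplier of the Bochner–Riesz operator of complex order `z`, as a function of the
frequency `η = ξ / 2π` dual to `x` in Mathlib's transform `𝓕`. -/
def bochnerRieszMultiplier (z : ℂ) (η : V) : ℂ := ballProfile z ‖(2 * π) • η‖

lemma norm_bochnerRieszMultiplier_le {z : ℂ} (hz : z.re = 0) (η : V) :
    ‖bochnerRieszMultiplier z η‖ ≤ 1 := by
  unfold bochnerRieszMultiplier ballProfile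
  split_ifs with h
  · rw [Complex.norm_cpow_eq_rpow_re_of_pos (by nlinarith [norm_nonneg ((2 * π) • η)]), hz,
      Real.rpow_zero]
  · simp only [norm_zero, zero_le_one]

variable [FiniteDimensional ℝ V] [MeasurableSpace V] [BorelSpace V] [Nontrivial V]

lemma integrable_bochnerRieszMultiplier {z : ℂ} (hz : -1 < z.re) :
    Integrable (bochnerRieszMultiplier z : V → ℂ) :=
  (integrable_ballProfile_norm volume hz).comp_smul (by positivity)

lemma fourierInv_bochnerRieszMultiplier {z : ℂ} (hz : -1 < z.re) (x : V) :
    𝓕⁻ (bochnerRieszMultiplier z : V → ℂ) x = Gamma (z + 1) * bochnerRieszKernel z x := by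
  have h := Measure.integral_comp_smul (volume : Measure V) (fun ξ : V =>
    ballProfile z ‖ξ‖ * Complex.exp (I * (inner ℝ x ξ : ℂ))) (2 * π)
  rw [integral_ballProfile_mul_exp hz, abs_of_pos (by positivity), Complex.real_smul,
    Complex.ofReal_inv] at h
  calc 𝓕⁻ (bochnerRieszMultiplier z : V → ℂ) x
      = ∫ η : V, ballProfile z ‖(2 * π) • η‖ *
          Complex.exp (I * (inner ℝ x ((2 * π) • η) : ℂ)) := by
        rw [Real.fourierInv_eq']
        refine integral_congr_ae (Eventually.of_forall fun η => ?_)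
        simp only [bochnerRieszMultiplier, smul_eq_mul, real_inner_smul_right, real_inner_comm η x]
        rw [mul_comm, mul_comm I]
    _ = Gamma (z + 1) * bochnerRieszKernel z x := by
        rw [h, bochnerRieszKernel]
        ring

lemma fourier_exp_mul_bochnerRieszMultiplier {z : ℂ} (hz : -1 < z.re) (x y : V) :
    𝓕 (fun η : V => Complex.exp (↑(2 * π * inner ℝ η x) * I) * bochnerRieszMultiplier z η) y =
      Gamma (z + 1) * bochnerRieszKernel z (x - y) := by
  rw [← fourierInv_bochnerRieszMultiplier hz, Real.fourier_eq', Real.fourierInv_eq']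
  refine integral_congr_ae (Eventually.of_forall fun η => ?_)
  simp only [smul_eq_mul]
  rw [← mul_assoc, ← Complex.exp_add, inner_sub_right]
  congr 2
  push_cast
  ring

lemma fourierInv_bochnerRieszMultiplier_mul_fourier {z : ℂ} (hz : -1 < z.re) {f : V → ℂ}
    (hf : Integrable f) (x : V) :
    𝓕⁻ (fun η => bochnerRieszMultiplier z η * 𝓕 f η) x =
      Gamma (z + 1) * ∫ y, f y * bochnerRieszKernel z (x - y) := by
  have hg : Integrable fun η : V =>
      Complex.exp (↑(2 * π * inner ℝ η x) * I) * bochnerRieszMultiplier z η := by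
    refine (integrable_bochnerRieszMultiplier hz).bdd_mul (c := 1)
      (Continuous.aestronglyMeasurable (by fun_prop)) (Eventually.of_forall fun η => ?_)
    rw [Complex.norm_exp_ofReal_mul_I]
  calc 𝓕⁻ (fun η => bochnerRieszMultiplier z η * 𝓕 f η) x
      = ∫ η, 𝓕 f η • (Complex.exp (↑(2 * π * inner ℝ η x) * I) * bochnerRieszMultiplier z η) := by
        rw [Real.fourierInv_eq']
        refine integral_congr_ae (Eventually.of_forall fun η => ?_)
        simp only [smul_eq_mul]
        ring
    _ = ∫ y, f y • (Gamma (z + 1) * bochnerRieszKernel z (x - y)) := by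
        simp only [integral_fourier_smul_eq_of_integrable hf hg,
          fourier_exp_mul_bochnerRieszMultiplier hz]
    _ = Gamma (z + 1) * ∫ y, f y * bochnerRieszKernel z (x - y) := by
        simp only [smul_eq_mul, mul_left_comm _ (Gamma (z + 1)), integral_const_mul]

lemma integral_mul_integral_bochnerRieszKernel_eq {z : ℂ} (hz : -1 < z.re) {f g : V → ℂ}
    (hf : Integrable f) (hg : Integrable g) :
    Gamma (z + 1) * ∫ x, g x * ∫ y, f y * bochnerRieszKernel z (x - y) =
      ∫ ξ, 𝓕 g ξ * (bochnerRieszMultiplier z (-ξ) * 𝓕 f (-ξ)) := by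
  have hfm : Integrable fun η : V => bochnerRieszMultiplier z η * 𝓕 f η :=
    (integrable_bochnerRieszMultiplier hz).mul_bdd (c := ∫ v, ‖f v‖)
      (continuous_fourier_of_integrable hf).aestronglyMeasurable
      (Eventually.of_forall fun η => norm_fourier_le_integral_norm f η)
  have h := integral_fourier_smul_eq_of_integrable hg hfm.comp_neg
  rw [← Real.fourierInv_eq_fourier_comp_neg (fun η => bochnerRieszMultiplier z η * 𝓕 f η)] at h
  simp only [smul_eq_mul, fourierInv_bochnerRieszMultiplier_mul_fourier hz hf] at h
  simp only [h, mul_left_comm _ (Gamma (z + 1)), integral_const_mul]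

/-- Plancherel: the multiplier of the operator is unimodular on its support when `Re z = 0`. -/
lemma norm_integral_mul_integral_bochnerRieszKernel_le {z : ℂ} (hz : z.re = 0) {f g : V → ℂ}
    (hf : Integrable f) (hf2 : MemLp f 2) (hg : Integrable g) (hg2 : MemLp g 2) :
    ‖Gamma (z + 1) * ∫ x, g x * ∫ y, f y * bochnerRieszKernel z (x - y)‖ ≤
      (∫ x, ‖f x‖ ^ (2 : ℝ)) ^ (1 / 2 : ℝ) * (∫ x, ‖g x‖ ^ (2 : ℝ)) ^ (1 / 2 : ℝ) := by
  have hF : MemLp (fun ξ => 𝓕 f (-ξ)) 2 :=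
    (memLp_two_fourier hf hf2).comp_measurePreserving (Measure.measurePreserving_neg volume)
  have hG := memLp_two_fourier hg hg2
  have hbound : ∀ ξ : V, ‖𝓕 g ξ * (bochnerRieszMultiplier z (-ξ) * 𝓕 f (-ξ))‖ ≤
      ‖𝓕 f (-ξ)‖ * ‖𝓕 g ξ‖ := fun ξ => by
    rw [norm_mul, norm_mul, mul_comm]
    exact mul_le_mul_of_nonneg_right (mul_le_of_le_one_left (norm_nonneg _)
      (norm_bochnerRieszMultiplier_le hz _)) (norm_nonneg _)
  rw [integral_mul_integral_bochnerRieszKernel_eq (by rw [hz]; norm_num) hf hg]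
  calc ‖∫ ξ, 𝓕 g ξ * (bochnerRieszMultiplier z (-ξ) * 𝓕 f (-ξ))‖
      ≤ ∫ ξ, ‖𝓕 f (-ξ)‖ * ‖𝓕 g ξ‖ :=
        norm_integral_le_of_norm_le (hF.norm.integrable_mul hG.norm)
          (Eventually.of_forall hbound)
    _ ≤ (∫ ξ, ‖𝓕 f (-ξ)‖ ^ (2 : ℝ)) ^ (1 / 2 : ℝ) * (∫ ξ, ‖𝓕 g ξ‖ ^ (2 : ℝ)) ^ (1 / 2 : ℝ) :=
        integral_mul_norm_le_Lp_mul_Lq Real.HolderConjugate.two_two (by simpa using hF)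
          (by simpa using hG)
    _ = (∫ x, ‖f x‖ ^ (2 : ℝ)) ^ (1 / 2 : ℝ) * (∫ x, ‖g x‖ ^ (2 : ℝ)) ^ (1 / 2 : ℝ) := by
        rw [integral_neg_eq_self (fun ξ => ‖𝓕 f ξ‖ ^ (2 : ℝ)),
          integral_norm_rpow_two_fourier hf hf2, integral_norm_rpow_two_fourier hg hg2]

end Kernel

section ParametricIntegral

variable {α 𝕜 E : Type*} [MeasurableSpace α] {μ : Measure α} [NormedAddCommGroup E]

lemma aestronglyMeasurable_deriv_of_eventually [NontriviallyNormedField 𝕜] [NormedSpace 𝕜 E]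
    {Φ : 𝕜 → α → E} {z₀ : 𝕜} (hm : ∀ᶠ z in 𝓝 z₀, AEStronglyMeasurable (Φ z) μ)
    (hd : ∀ a, DifferentiableAt 𝕜 (fun z => Φ z a) z₀) :
    AEStronglyMeasurable (fun a => deriv (fun z => Φ z a) z₀) μ := by
  obtain ⟨u, hu⟩ := exists_seq_tendsto (𝓝[≠] z₀)
  obtain ⟨N, hN⟩ := eventually_atTop.1 ((hu.mono_right nhdsWithin_le_nhds).eventually hm)
  refine aestronglyMeasurable_of_tendsto_ae atTop
    (f := fun k a => slope (fun z => Φ z a) z₀ (u (k + N))) (fun k => ?_)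
    (Eventually.of_forall fun a =>
      (hd a).hasDerivAt.tendsto_slope.comp (hu.comp (tendsto_add_atTop_nat N)))
  exact ((hN _ (Nat.le_add_left N k)).sub hm.self_of_nhds).const_smul _

lemma differentiableOn_integral_of_norm_le [NormedSpace ℂ E]
    {U : Set ℂ} {Φ : ℂ → α → E} {bound : α → ℝ} (hU : IsOpen U)
    (hm : ∀ z ∈ U, AEStronglyMeasurable (Φ z) μ) (hd : ∀ a, DifferentiableOn ℂ (fun z => Φ z a) U)
    (hb : ∀ z ∈ U, ∀ a, ‖Φ z a‖ ≤ bound a) (hi : Integrable bound μ) :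
    DifferentiableOn ℂ (fun z => ∫ a, Φ z a ∂μ) U := by
  intro z₀ hz₀
  obtain ⟨ε, hε, hball⟩ := Metric.isOpen_iff.1 hU z₀ hz₀
  have hε2 : 0 < ε / 2 := half_pos hε
  have hsub : ∀ z ∈ Metric.ball z₀ (ε / 2), Metric.closedBall z (ε / 2) ⊆ U := fun z hz =>
    (Metric.closedBall_subset_ball' (by linarith [Metric.mem_ball.1 hz])).trans hball
  have hderiv : ∀ a, ∀ z ∈ Metric.ball z₀ (ε / 2),
      HasDerivAt (fun z => Φ z a) (deriv (fun z => Φ z a) z) z := fun a z hz =>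
    ((hd a).differentiableAt
      (hU.mem_nhds (hsub z hz (Metric.mem_closedBall_self hε2.le)))).hasDerivAt
  have hcauchy : ∀ a, ∀ z ∈ Metric.ball z₀ (ε / 2),
      ‖deriv (fun z => Φ z a) z‖ ≤ bound a / (ε / 2) := fun a z hz =>
    Complex.norm_deriv_le_of_forall_mem_sphere_norm_le hε2
      (((hd a).mono (hsub z hz)).diffContOnCl_ball subset_rfl)
      fun w hw => hb w (hsub z hz (Metric.sphere_subset_closedBall hw)) a
  have hmeas := aestronglyMeasurable_deriv_of_eventually
    ((hU.eventually_mem hz₀).mono hm) fun a => (hd a).differentiableAt (hU.mem_nhds hz₀)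
  exact (hasDerivAt_integral_of_dominated_loc_of_deriv_le (Metric.ball_mem_nhds z₀ hε2)
    ((hU.eventually_mem hz₀).mono hm)
    (hi.mono' (hm z₀ hz₀) (Eventually.of_forall (hb z₀ hz₀))) hmeas
    (Eventually.of_forall hcauchy) (hi.div_const _)
    (Eventually.of_forall hderiv)).2.differentiableAt.differentiableWithinAt

lemma diffContOnCl_integral_of_norm_le [NormedSpace ℂ E]
    {U : Set ℂ} {Φ : ℂ → α → E} {bound : α → ℝ} (hU : IsOpen U)
    (hm : ∀ z ∈ closure U, AEStronglyMeasurable (Φ z) μ)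
    (hd : ∀ a, DiffContOnCl ℂ (fun z => Φ z a) U)
    (hb : ∀ z ∈ closure U, ∀ a, ‖Φ z a‖ ≤ bound a) (hi : Integrable bound μ) :
    DiffContOnCl ℂ (fun z => ∫ a, Φ z a ∂μ) U :=
  ⟨differentiableOn_integral_of_norm_le hU (fun z hz => hm z (subset_closure hz))
      (fun a => (hd a).differentiableOn) (fun z hz => hb z (subset_closure hz)) hi,
    continuousOn_of_dominated hm (fun z hz => Eventually.of_forall (hb z hz)) hi
      (Eventually.of_forall fun a => (hd a).continuousOn)⟩

end ParametricIntegral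

section Continuation

variable {V : Type*} [NormedAddCommGroup V] [InnerProductSpace ℝ V]

lemma exists_norm_mul_bochnerRieszKernel_le {f : V → ℂ} (hfs : HasCompactSupport f)
    (R : ℝ) (x : V) :
    ∃ M : ℝ, ∀ z : ℂ, ‖z‖ ≤ R → ∀ y, ‖f y * bochnerRieszKernel z (x - y)‖ ≤ M * ‖f y‖ := by
  have hcont : Continuous fun p : ℂ × V => bochnerRieszKernel p.1 (x - p.2) :=
    (continuous_bochnerRieszKernel.comp
      (show Continuous fun p : ℂ × V => (p.1, x - p.2) by fun_prop) :)
  obtain ⟨M, hM⟩ := ((isCompact_closedBall (0 : ℂ) R).prod hfs).exists_bound_of_continuousOn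
    hcont.continuousOn
  refine ⟨M, fun z hz y => ?_⟩
  by_cases hy : f y = 0
  · simp only [hy, zero_mul, norm_zero, mul_zero, le_refl]
  · rw [norm_mul, mul_comm]
    exact mul_le_mul_of_nonneg_right
      (hM (z, y) ⟨mem_closedBall_zero_iff.2 hz, subset_tsupport f hy⟩) (norm_nonneg _)

lemma exists_norm_interpolationWeight_mul_bochnerRieszKernel_le
    (V : Type*) [NormedAddCommGroup V] [InnerProductSpace ℝ V] [FiniteDimensional ℝ V]
    [Nontrivial V] :
    ∃ C : ℝ, 0 ≤ C ∧ ∀ z : ℂ, -(((finrank ℝ V : ℝ) + 1) / 2) ≤ z.re → ∀ x : V,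
      ‖interpolationWeight (finrank ℝ V) z * bochnerRieszKernel z x‖ ≤ C := by
  obtain ⟨C, hC0, hC⟩ := exists_norm_interpolationWeight_mul_besselClifford_le
    (Module.finrank_pos (R := ℝ) (M := V))
  refine ⟨‖(((2 * π) ^ finrank ℝ V : ℝ) : ℂ)⁻¹ * (π : ℂ) ^ (finrank ℝ V / 2 : ℂ)‖ * C,
    by positivity, fun z hz x => ?_⟩
  rw [bochnerRieszKernel, mul_left_comm, norm_mul]
  exact mul_le_mul_of_nonneg_left (hC z hz _ (norm_nonneg x)) (norm_nonneg _)

variable [FiniteDimensional ℝ V] [MeasurableSpace V] [BorelSpace V]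

/-- The analytically continued Bochner–Riesz operator `S̃ ^ z`, as convolution with its kernel. -/
def analyticBochnerRiesz (z : ℂ) (f : V → ℂ) (x : V) : ℂ :=
  ∫ y, f y * bochnerRieszKernel z (x - y)

lemma aestronglyMeasurable_mul_bochnerRieszKernel {f : V → ℂ} (hf : AEStronglyMeasurable f)
    (z : ℂ) (x : V) : AEStronglyMeasurable fun y => f y * bochnerRieszKernel z (x - y) :=
  hf.mul (continuous_bochnerRieszKernel.comp
    (show Continuous fun y : V => (z, x - y) by fun_prop) :).aestronglyMeasurable

lemma integrable_mul_bochnerRieszKernel {f : V → ℂ} (hf : Integrable f)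
    (hfs : HasCompactSupport f) (z : ℂ) (x : V) :
    Integrable fun y => f y * bochnerRieszKernel z (x - y) := by
  obtain ⟨M, hM⟩ := exists_norm_mul_bochnerRieszKernel_le hfs ‖z‖ x
  exact (hf.norm.const_mul M).mono' (aestronglyMeasurable_mul_bochnerRieszKernel hf.1 z x)
    (Eventually.of_forall (hM z le_rfl))

lemma analyticBochnerRiesz_add {f g : V → ℂ} (hf : Integrable f) (hfs : HasCompactSupport f)
    (hg : Integrable g) (hgs : HasCompactSupport g) (z : ℂ) :
    analyticBochnerRiesz z (f + g) = analyticBochnerRiesz z f + analyticBochnerRiesz z g := by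
  ext x
  simp only [analyticBochnerRiesz, Pi.add_apply, add_mul]
  exact integral_add (integrable_mul_bochnerRieszKernel hf hfs z x)
    (integrable_mul_bochnerRieszKernel hg hgs z x)

lemma analyticBochnerRiesz_smul (c : ℂ) (f : V → ℂ) (z : ℂ) :
    analyticBochnerRiesz z (c • f) = c • analyticBochnerRiesz z f := by
  ext x
  simp only [analyticBochnerRiesz, Pi.smul_apply, smul_eq_mul, mul_assoc, integral_const_mul]

lemma differentiable_analyticBochnerRiesz {f : V → ℂ} (hf : Integrable f)
    (hfs : HasCompactSupport f) (x : V) :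
    Differentiable ℂ fun z => analyticBochnerRiesz z f x := by
  intro z₀
  obtain ⟨M, hM⟩ := exists_norm_mul_bochnerRieszKernel_le hfs (‖z₀‖ + 1) x
  have hdiff : DifferentiableOn ℂ (fun z => analyticBochnerRiesz z f x)
      (Metric.ball 0 (‖z₀‖ + 1)) :=
    differentiableOn_integral_of_norm_le Metric.isOpen_ball
      (fun z _ => aestronglyMeasurable_mul_bochnerRieszKernel hf.1 z x)
      (fun y => ((differentiable_bochnerRieszKernel (x - y)).const_mul (f y)).differentiableOn)
      (fun z hz => hM z (mem_ball_zero_iff.1 hz).le) (hf.norm.const_mul M)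
  exact hdiff.differentiableAt
    (Metric.isOpen_ball.mem_nhds (mem_ball_zero_iff.2 (lt_add_one _)))

end Continuation

section EuclideanContinuation

variable {n : ℕ} {f : EuclideanSpace ℝ (Fin n) → ℂ}

lemma ofReal_bochnerRieszSymbol (s : ℝ) (η : EuclideanSpace ℝ (Fin n)) :
    (bochnerRieszSymbol s ((2 * π) • η) : ℂ) = bochnerRieszMultiplier s η := by
  unfold bochnerRieszSymbol bochnerRieszMultiplier ballProfile
  by_cases h : ‖(2 * π) • η‖ < 1
  · rw [Set.indicator_of_mem (mem_ball_zero_iff.2 h), if_pos h,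
      Complex.ofReal_cpow (by nlinarith [norm_nonneg ((2 * π) • η)])]
  · rw [Set.indicator_of_notMem (fun h' => h (mem_ball_zero_iff.1 h')), if_neg h,
      Complex.ofReal_zero]

lemma isBochnerRieszContinuation_analyticBochnerRiesz (hn : 1 ≤ n) (hf : Integrable f)
    (hfs : HasCompactSupport f) (x : EuclideanSpace ℝ (Fin n)) :
    IsBochnerRieszContinuation f x fun z => analyticBochnerRiesz z f x := by
  have : NeZero n := ⟨by omega⟩
  refine ⟨differentiable_analyticBochnerRiesz hf hfs x, fun s hs => ?_⟩
  have hΓ : Gamma ((s : ℂ) + 1) ≠ 0 := Complex.Gamma_ne_zero_of_re_pos (by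
    rw [Complex.add_re, Complex.ofReal_re, Complex.one_re]
    linarith)
  have hre : -1 < (s : ℂ).re := by rwa [Complex.ofReal_re]
  simp only [bochnerRiesz, ofReal_bochnerRieszSymbol]
  rw [fourierInv_bochnerRieszMultiplier_mul_fourier hre hf, inv_mul_cancel_left₀ hΓ,
    analyticBochnerRiesz]

lemma isAnalyticBochnerRiesz_analyticBochnerRiesz (hn : 1 ≤ n) (hf : Integrable f)
    (hfs : HasCompactSupport f) (z : ℂ) :
    IsAnalyticBochnerRiesz z f (analyticBochnerRiesz z f) := fun x =>
  ⟨_, isBochnerRieszContinuation_analyticBochnerRiesz hn hf hfs x, rfl⟩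

end EuclideanContinuation

section PhasePower

variable {α : Type*}

/-- The complex power `|f| ^ l · f / |f|` of a function, which keeps the phase of `f`. It is `f`
itself for `l = 1`, and vanishes where `f` does. -/
def phasePower (l : ℂ) (f : α → ℂ) (x : α) : ℂ := f x * (‖f x‖ : ℂ) ^ (l - 1)

lemma norm_phasePower {l : ℂ} (hl : 0 < l.re) (f : α → ℂ) (x : α) :
    ‖phasePower l f x‖ = ‖f x‖ ^ l.re := by
  unfold phasePower
  rcases (norm_nonneg (f x)).eq_or_lt with h | h
  · rw [norm_mul, ← h, zero_mul, Real.zero_rpow hl.ne']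
  · rw [norm_mul, Complex.norm_cpow_eq_rpow_re_of_pos h, Complex.sub_re, Complex.one_re,
      Real.rpow_sub_one h.ne', mul_div_cancel₀ _ h.ne']

lemma norm_phasePower_rpow {l : ℂ} (hl : 0 < l.re) {p r : ℝ} (hlr : l.re * r = p) (f : α → ℂ)
    (x : α) : ‖phasePower l f x‖ ^ r = ‖f x‖ ^ p := by
  rw [norm_phasePower hl, ← Real.rpow_mul (norm_nonneg _), hlr]

lemma phasePower_one (f : α → ℂ) : phasePower 1 f = f := by
  ext x
  rw [phasePower, sub_self, Complex.cpow_zero, mul_one]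

lemma differentiable_phasePower {l : ℂ → ℂ} (hl : Differentiable ℂ l) (f : α → ℂ) (x : α) :
    Differentiable ℂ fun z => phasePower (l z) f x := by
  unfold phasePower
  by_cases h : f x = 0
  · simp only [h, zero_mul, differentiable_const]
  · exact Differentiable.const_mul (fun z => DifferentiableAt.const_cpow
      ((hl z).sub_const 1) (Or.inl (Complex.ofReal_ne_zero.2 (norm_ne_zero_iff.2 h)))) _

variable [MeasurableSpace α] {μ : Measure α} {f : α → ℂ} {p : ℝ}

lemma aestronglyMeasurable_phasePower (hf : AEStronglyMeasurable f μ) (l : ℂ) :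
    AEStronglyMeasurable (phasePower l f) μ :=
  (hf.aemeasurable.mul
    ((Complex.measurable_ofReal.comp_aemeasurable hf.norm.aemeasurable).pow_const
      (l - 1))).aestronglyMeasurable

lemma integrable_norm_rpow_of_memLp (hp : 0 < p) (hf : MemLp f (ENNReal.ofReal p) μ) :
    Integrable (fun x => ‖f x‖ ^ p) μ := by
  have h := hf.integrable_norm_rpow (ENNReal.ofReal_pos.2 hp).ne' ENNReal.ofReal_ne_top
  rwa [ENNReal.toReal_ofReal hp.le] at h

lemma ofReal_rpow_integral_norm_rpow (hp : 0 < p) (hf : MemLp f (ENNReal.ofReal p) μ) :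
    ENNReal.ofReal ((∫ x, ‖f x‖ ^ p ∂μ) ^ p⁻¹) = eLpNorm f (ENNReal.ofReal p) μ := by
  rw [hf.eLpNorm_eq_integral_rpow_norm (ENNReal.ofReal_pos.2 hp).ne' ENNReal.ofReal_ne_top,
    ENNReal.toReal_ofReal hp.le]

lemma exists_integrable_norm_phasePower_le (hp : 0 < p) (hf : MemLp f (ENNReal.ofReal p) μ)
    (hfs : μ (Function.support f) ≠ ∞) :
    ∃ B : α → ℝ, Integrable B μ ∧
      ∀ l : ℂ, 0 < l.re → l.re ≤ p → ∀ x, ‖phasePower l f x‖ ≤ B x := by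
  refine ⟨fun x => (toMeasurable μ (Function.support f)).indicator (fun _ => (1 : ℝ)) x +
    ‖f x‖ ^ p, ?_, fun l hl hlp x => ?_⟩
  · exact ((integrable_indicator_iff (measurableSet_toMeasurable _ _)).2
      (integrableOn_const (by rwa [measure_toMeasurable]))).add
        (integrable_norm_rpow_of_memLp hp hf)
  · have hfp : 0 ≤ ‖f x‖ ^ p := Real.rpow_nonneg (norm_nonneg _) _
    rw [norm_phasePower hl]
    by_cases h : f x = 0
    · have h0 : ‖f x‖ ^ l.re = 0 := by rw [h, norm_zero, Real.zero_rpow hl.ne']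
      rw [h0]
      exact add_nonneg (Set.indicator_nonneg (fun _ _ => zero_le_one) _) hfp
    · simp only [Set.indicator_of_mem (subset_toMeasurable μ (Function.support f) h)]
      rcases le_total ‖f x‖ 1 with h1 | h1
      · linarith [Real.rpow_le_one (norm_nonneg (f x)) h1 hl.le]
      · linarith [Real.rpow_le_rpow_of_exponent_le h1 hlp]

lemma memLp_phasePower (hp : 0 < p) {l : ℂ} (hl : 0 < l.re) {r : ℝ} (hlr : l.re * r = p)
    (hf : MemLp f (ENNReal.ofReal p) μ) : MemLp (phasePower l f) (ENNReal.ofReal r) μ := by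
  have hr : 0 < r := pos_of_mul_pos_right (hlr ▸ hp) hl.le
  rw [← integrable_norm_rpow_iff (aestronglyMeasurable_phasePower hf.1 l)
    (ENNReal.ofReal_pos.2 hr).ne' ENNReal.ofReal_ne_top, ENNReal.toReal_ofReal hr.le]
  simpa only [norm_phasePower_rpow hl hlr] using integrable_norm_rpow_of_memLp hp hf

lemma integrable_phasePower (hp : 0 < p) {l : ℂ} (hl : 0 < l.re) (hlp : l.re ≤ p)
    (hf : MemLp f (ENNReal.ofReal p) μ) (hfs : μ (Function.support f) ≠ ∞) :
    Integrable (phasePower l f) μ := by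
  obtain ⟨B, hB, hle⟩ := exists_integrable_norm_phasePower_le hp hf hfs
  exact hB.mono' (aestronglyMeasurable_phasePower hf.1 l) (Eventually.of_forall (hle l hl hlp))

end PhasePower

section Stein

/-- The affine function of `z` with real part `1/p₀` for `Re z = a` and `1/p₁` for `Re z = b`,
which is real for `Im z = t`. -/
def reciprocalExponent (a b t p₀ p₁ : ℝ) (z : ℂ) : ℂ :=
  (1 - (z - t * I - a) / (b - a)) * (p₀ : ℂ)⁻¹ + (z - t * I - a) / (b - a) * (p₁ : ℂ)⁻¹

lemma differentiable_reciprocalExponent (a b t p₀ p₁ : ℝ) :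
    Differentiable ℂ (reciprocalExponent a b t p₀ p₁) := by
  unfold reciprocalExponent
  fun_prop

lemma reciprocalExponent_im_self (a b p₀ p₁ : ℝ) (w : ℂ) :
    reciprocalExponent a b w.im p₀ p₁ w =
      (((1 - (w.re - a) / (b - a)) * p₀⁻¹ + (w.re - a) / (b - a) * p₁⁻¹ : ℝ) : ℂ) := by
  have hw : w - w.im * I = w.re := sub_eq_of_eq_add (Complex.re_add_im w).symm
  rw [reciprocalExponent, hw]
  push_cast
  rfl

lemma re_reciprocalExponent (a b t p₀ p₁ : ℝ) (z : ℂ) :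
    (reciprocalExponent a b t p₀ p₁ z).re =
      (1 - (z.re - a) / (b - a)) * p₀⁻¹ + (z.re - a) / (b - a) * p₁⁻¹ := by
  have hs : ((z - t * I - a) / (b - a)).re = (z.re - a) / (b - a) := by
    rw [← Complex.ofReal_sub b a, Complex.div_ofReal_re]
    simp only [Complex.sub_re, Complex.mul_re, Complex.ofReal_re, Complex.ofReal_im, Complex.I_re,
      Complex.I_im, mul_zero, zero_mul, sub_zero]
  rw [reciprocalExponent, Complex.add_re, ← Complex.ofReal_inv, ← Complex.ofReal_inv,
    Complex.re_mul_ofReal, Complex.re_mul_ofReal, Complex.sub_re, Complex.one_re, hs]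

lemma div_sub_mem_Icc {a b x : ℝ} (hab : a < b) (hx : x ∈ Set.Icc a b) :
    (x - a) / (b - a) ∈ Set.Icc (0 : ℝ) 1 :=
  ⟨div_nonneg (sub_nonneg.2 hx.1) (sub_nonneg.2 hab.le),
    (div_le_one (sub_pos.2 hab)).2 (sub_le_sub_right hx.2 a)⟩

lemma re_reciprocalExponent_mem_Ioc {a b p₀ p₁ : ℝ} (hab : a < b) (hp₀ : 1 ≤ p₀) (hp₁ : 1 ≤ p₁)
    (t : ℝ) {z : ℂ} (hz : z.re ∈ Set.Icc a b) :
    (reciprocalExponent a b t p₀ p₁ z).re ∈ Set.Ioc 0 1 := by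
  have hmem : ∀ {p : ℝ}, 1 ≤ p → p⁻¹ ∈ Set.Ioc (0 : ℝ) 1 := fun hp =>
    ⟨inv_pos.2 (zero_lt_one.trans_le hp), inv_le_one_of_one_le₀ hp⟩
  obtain ⟨hs0, hs1⟩ := div_sub_mem_Icc hab hz
  rw [re_reciprocalExponent]
  exact convex_Ioc 0 1 (hmem hp₀) (hmem hp₁) (sub_nonneg.2 hs1) hs0 (sub_add_cancel _ _)

lemma re_reciprocalExponent_left {a b t p₀ p₁ : ℝ} {z : ℂ} (hz : z.re = a) :
    (reciprocalExponent a b t p₀ p₁ z).re = p₀⁻¹ := by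
  rw [re_reciprocalExponent, hz, sub_self, zero_div, sub_zero, one_mul, zero_mul, add_zero]

lemma re_reciprocalExponent_right {a b t p₀ p₁ : ℝ} (hab : a < b) {z : ℂ} (hz : z.re = b) :
    (reciprocalExponent a b t p₀ p₁ z).re = p₁⁻¹ := by
  rw [re_reciprocalExponent, hz, div_self (sub_pos.2 hab).ne', sub_self, zero_mul, one_mul,
    zero_add]

lemma rpow_interpolation_mul {A₀ A₁ x y : ℝ} (hA₀ : 0 ≤ A₀) (hA₁ : 0 ≤ A₁) (hx : 0 ≤ x)
    (hy : 0 ≤ y) {θ a₀ a₁ b₀ b₁ : ℝ} (hθ : θ ∈ Set.Icc 0 1) (ha₀ : 0 ≤ a₀) (ha₁ : 0 ≤ a₁)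
    (hb₀ : 0 ≤ b₀) (hb₁ : 0 ≤ b₁) :
    (A₀ * (x ^ a₀ * y ^ b₀)) ^ (1 - θ) * (A₁ * (x ^ a₁ * y ^ b₁)) ^ θ =
      A₀ ^ (1 - θ) * A₁ ^ θ *
        (x ^ ((1 - θ) * a₀ + θ * a₁) * y ^ ((1 - θ) * b₀ + θ * b₁)) := by
  have hθ' : 0 ≤ 1 - θ := sub_nonneg.2 hθ.2
  have hsplit : ∀ {x a b : ℝ}, 0 ≤ x → 0 ≤ a → 0 ≤ b →
      x ^ ((1 - θ) * a + θ * b) = (x ^ a) ^ (1 - θ) * (x ^ b) ^ θ := fun hx ha hb => by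
    rw [Real.rpow_add_of_nonneg hx (mul_nonneg hθ' ha) (mul_nonneg hθ.1 hb), mul_comm (1 - θ),
      mul_comm θ, Real.rpow_mul hx, Real.rpow_mul hx]
  have hpow : ∀ {A a b t : ℝ}, 0 ≤ A → (A * (x ^ a * y ^ b)) ^ t =
      A ^ t * ((x ^ a) ^ t * (y ^ b) ^ t) := fun hA => by
    rw [Real.mul_rpow hA (by positivity), Real.mul_rpow (by positivity) (by positivity)]
  rw [hsplit hx ha₀ ha₁, hsplit hy hb₀ hb₁, hpow hA₀, hpow hA₁]
  ring

variable {α β : Type*} [MeasurableSpace α] [MeasurableSpace β]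

/-- The bilinear form with integral kernel `k` is bounded on `L^p × L^q` with constant `A`, when
tested on integrable functions. -/
def KernelFormBound (k : α × β → ℂ) (p q : ℝ) (μ : Measure α) (ν : Measure β) (A : ℝ) : Prop :=
  ∀ ⦃f : α → ℂ⦄ ⦃g : β → ℂ⦄, Integrable f μ → MemLp f (ENNReal.ofReal p) μ →
    Integrable g ν → MemLp g (ENNReal.ofReal q) ν →
    ‖∫ x, k x * (f x.1 * g x.2) ∂μ.prod ν‖ ≤
      A * ((∫ x, ‖f x‖ ^ p ∂μ) ^ p⁻¹ * (∫ y, ‖g y‖ ^ q ∂ν) ^ q⁻¹)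

variable {μ : Measure α} {ν : Measure β}

lemma KernelFormBound.norm_integral_phasePower_le {k : α × β → ℂ} {p q p₀ q₀ A : ℝ}
    (hk : KernelFormBound k p₀ q₀ μ ν A) (hp : 0 < p) (hq : 0 < q) (hp₀ : 1 ≤ p₀) (hq₀ : 1 ≤ q₀)
    {l m : ℂ} (hl : l.re = p₀⁻¹) (hm : m.re = q₀⁻¹) {f : α → ℂ} {g : β → ℂ}
    (hf : MemLp f (ENNReal.ofReal p) μ) (hfs : μ (Function.support f) ≠ ∞)
    (hg : MemLp g (ENNReal.ofReal q) ν) (hgs : ν (Function.support g) ≠ ∞) :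
    ‖∫ x, k x * (phasePower (p * l) f x.1 * phasePower (q * m) g x.2) ∂μ.prod ν‖ ≤
      A * ((∫ x, ‖f x‖ ^ p ∂μ) ^ p₀⁻¹ * (∫ y, ‖g y‖ ^ q ∂ν) ^ q₀⁻¹) := by
  have hre : ∀ {r r₀ : ℝ} {l : ℂ}, 0 < r → 1 ≤ r₀ → l.re = r₀⁻¹ →
      0 < ((r : ℂ) * l).re ∧ ((r : ℂ) * l).re ≤ r ∧ ((r : ℂ) * l).re * r₀ = r := by
    intro r r₀ l hr hr₀ hl
    have hr₀_pos : 0 < r₀ := zero_lt_one.trans_le hr₀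
    rw [Complex.re_ofReal_mul, hl]
    exact ⟨by positivity, mul_le_of_le_one_right hr.le (inv_le_one_of_one_le₀ hr₀),
      inv_mul_cancel_right₀ hr₀_pos.ne' r⟩
  obtain ⟨hl_pos, hl_le, hl_eq⟩ := hre hp hp₀ hl
  obtain ⟨hm_pos, hm_le, hm_eq⟩ := hre hq hq₀ hm
  have h := hk (integrable_phasePower hp hl_pos hl_le hf hfs) (memLp_phasePower hp hl_pos hl_eq hf)
    (integrable_phasePower hq hm_pos hm_le hg hgs) (memLp_phasePower hq hm_pos hm_eq hg)
  simpa only [norm_phasePower_rpow hl_pos hl_eq, norm_phasePower_rpow hm_pos hm_eq] using h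

lemma closure_re_preimage_Ioo {a b : ℝ} (hab : a < b) :
    closure (Complex.re ⁻¹' Set.Ioo a b) = Complex.re ⁻¹' Set.Icc a b := by
  rw [Complex.closure_preimage_re, closure_Ioo hab.ne]

lemma exists_norm_le_and_diffContOnCl_integral_phasePower {a b p q B : ℝ} (hab : a < b)
    (hp : 0 < p) (hq : 0 < q) {K : ℂ → α × β → ℂ} {l m : ℂ → ℂ}
    (hKm : ∀ z, z.re ∈ Set.Icc a b → AEStronglyMeasurable (K z) (μ.prod ν))
    (hKd : ∀ x, DiffContOnCl ℂ (fun z => K z x) (Complex.re ⁻¹' Set.Ioo a b))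
    (hKB : ∀ z, z.re ∈ Set.Icc a b → ∀ x, ‖K z x‖ ≤ B)
    (hld : Differentiable ℂ l) (hl : ∀ z, z.re ∈ Set.Icc a b → (l z).re ∈ Set.Ioc 0 1)
    (hmd : Differentiable ℂ m) (hm : ∀ z, z.re ∈ Set.Icc a b → (m z).re ∈ Set.Ioc 0 1)
    {f : α → ℂ} {g : β → ℂ}
    (hf : MemLp f (ENNReal.ofReal p) μ) (hfs : μ (Function.support f) ≠ ∞)
    (hg : MemLp g (ENNReal.ofReal q) ν) (hgs : ν (Function.support g) ≠ ∞) :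
    let Ψ := fun z => ∫ x, K z x * (phasePower (p * l z) f x.1 * phasePower (q * m z) g x.2)
      ∂μ.prod ν
    DiffContOnCl ℂ Ψ (Complex.re ⁻¹' Set.Ioo a b) ∧
      ∃ M, ∀ z, z.re ∈ Set.Icc a b → ‖Ψ z‖ ≤ M := by
  have hre : ∀ {r : ℝ} {c : ℂ}, 0 < r → c.re ∈ Set.Ioc 0 1 →
      0 < ((r : ℂ) * c).re ∧ ((r : ℂ) * c).re ≤ r := fun hr hc => by
    rw [Complex.re_ofReal_mul]
    exact ⟨mul_pos hr hc.1, mul_le_of_le_one_right hr.le hc.2⟩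
  obtain ⟨Bf, hBf, hf_le⟩ := exists_integrable_norm_phasePower_le hp hf hfs
  obtain ⟨Bg, hBg, hg_le⟩ := exists_integrable_norm_phasePower_le hq hg hgs
  have hmeas : ∀ z, z.re ∈ Set.Icc a b → AEStronglyMeasurable (fun x => K z x *
      (phasePower (p * l z) f x.1 * phasePower (q * m z) g x.2)) (μ.prod ν) := fun z hz =>
    (hKm z hz).mul ((aestronglyMeasurable_phasePower hf.1 _).comp_fst.mul
      (aestronglyMeasurable_phasePower hg.1 _).comp_snd)
  have hbound : ∀ z, z.re ∈ Set.Icc a b → ∀ x : α × β,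
      ‖K z x * (phasePower (p * l z) f x.1 * phasePower (q * m z) g x.2)‖ ≤
        B * (Bf x.1 * Bg x.2) := fun z hz x => by
    have hfx := hf_le _ (hre hp (hl z hz)).1 (hre hp (hl z hz)).2 x.1
    have hgx := hg_le _ (hre hq (hm z hz)).1 (hre hq (hm z hz)).2 x.2
    rw [norm_mul, norm_mul (phasePower _ _ _)]
    exact mul_le_mul (hKB z hz x) (mul_le_mul hfx hgx (norm_nonneg _) ((norm_nonneg _).trans hfx))
      (by positivity) ((norm_nonneg _).trans (hKB z hz x))
  have hint : Integrable (fun x : α × β => B * (Bf x.1 * Bg x.2)) (μ.prod ν) :=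
    (hBf.mul_prod hBg).const_mul B
  refine ⟨diffContOnCl_integral_of_norm_le (isOpen_Ioo.preimage Complex.continuous_re)
      (by rwa [closure_re_preimage_Ioo hab]) (fun x => ?_)
      (by rwa [closure_re_preimage_Ioo hab]) hint,
    _, fun z hz => norm_integral_le_of_norm_le hint (Eventually.of_forall (hbound z hz))⟩
  have hdiff : Differentiable ℂ fun z =>
      phasePower (p * l z) f x.1 * phasePower (q * m z) g x.2 :=
    (differentiable_phasePower (hld.const_mul _) f _).mul
      (differentiable_phasePower (hmd.const_mul _) g _)
  exact (hKd x).smul hdiff.diffContOnCl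

/-- On each of the two lines, the norms of the phase powers are powers of the norms of `f` and `g`,
so that the three lines theorem applies to the form tested on the phase powers. -/
theorem norm_integral_le_of_stein_interpolation {a b : ℝ} (hab : a < b)
    {p q p₀ q₀ p₁ q₁ A₀ A₁ B : ℝ} (hp₀ : 1 ≤ p₀) (hq₀ : 1 ≤ q₀) (hp₁ : 1 ≤ p₁) (hq₁ : 1 ≤ q₁)
    (hA₀ : 0 ≤ A₀) (hA₁ : 0 ≤ A₁) {w : ℂ} (hw : w.re ∈ Set.Icc a b) {θ : ℝ}
    (hθ : θ = (w.re - a) / (b - a)) (hp : p⁻¹ = (1 - θ) * p₀⁻¹ + θ * p₁⁻¹)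
    (hq : q⁻¹ = (1 - θ) * q₀⁻¹ + θ * q₁⁻¹) {K : ℂ → α × β → ℂ}
    (hKm : ∀ z, z.re ∈ Set.Icc a b → AEStronglyMeasurable (K z) (μ.prod ν))
    (hKd : ∀ x, DiffContOnCl ℂ (fun z => K z x) (Complex.re ⁻¹' Set.Ioo a b))
    (hKB : ∀ z, z.re ∈ Set.Icc a b → ∀ x, ‖K z x‖ ≤ B)
    (hK₀ : ∀ z, z.re = a → KernelFormBound (K z) p₀ q₀ μ ν A₀)
    (hK₁ : ∀ z, z.re = b → KernelFormBound (K z) p₁ q₁ μ ν A₁)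
    {f : α → ℂ} {g : β → ℂ}
    (hf : MemLp f (ENNReal.ofReal p) μ) (hfs : μ (Function.support f) ≠ ∞)
    (hg : MemLp g (ENNReal.ofReal q) ν) (hgs : ν (Function.support g) ≠ ∞) :
    ‖∫ x, K w x * (f x.1 * g x.2) ∂μ.prod ν‖ ≤ A₀ ^ (1 - θ) * A₁ ^ θ *
      ((∫ x, ‖f x‖ ^ p ∂μ) ^ p⁻¹ * (∫ y, ‖g y‖ ^ q ∂ν) ^ q⁻¹) := by
  let l := reciprocalExponent a b w.im p₀ p₁
  let m := reciprocalExponent a b w.im q₀ q₁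
  have hlw : l w = (p : ℂ)⁻¹ := (reciprocalExponent_im_self a b p₀ p₁ w).trans
    (by rw [← hθ, ← hp, Complex.ofReal_inv])
  have hmw : m w = (q : ℂ)⁻¹ := (reciprocalExponent_im_self a b q₀ q₁ w).trans
    (by rw [← hθ, ← hq, Complex.ofReal_inv])
  have hl := fun z => re_reciprocalExponent_mem_Ioc hab hp₀ hp₁ w.im (z := z)
  have hm := fun z => re_reciprocalExponent_mem_Ioc hab hq₀ hq₁ w.im (z := z)
  have hp_pos : 0 < p := by
    have h : 0 < (l w).re := (hl w hw).1
    rwa [hlw, ← Complex.ofReal_inv, Complex.ofReal_re, inv_pos] at h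
  have hq_pos : 0 < q := by
    have h : 0 < (m w).re := (hm w hw).1
    rwa [hmw, ← Complex.ofReal_inv, Complex.ofReal_re, inv_pos] at h
  have hp_ne : (p : ℂ) ≠ 0 := Complex.ofReal_ne_zero.2 hp_pos.ne'
  have hq_ne : (q : ℂ) ≠ 0 := Complex.ofReal_ne_zero.2 hq_pos.ne'
  obtain ⟨hΨ, M, hM⟩ := exists_norm_le_and_diffContOnCl_integral_phasePower hab hp_pos hq_pos
    hKm hKd hKB (differentiable_reciprocalExponent a b w.im p₀ p₁) hl
    (differentiable_reciprocalExponent a b w.im q₀ q₁) hm hf hfs hg hgs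
  have h := Complex.HadamardThreeLines.norm_le_interp_of_mem_verticalClosedStrip' hab hw hΨ
    ⟨M, Set.forall_mem_image.2 fun z hz => hM z hz⟩
    (fun z hz => (hK₀ z hz).norm_integral_phasePower_le hp_pos hq_pos hp₀ hq₀
      (re_reciprocalExponent_left hz) (re_reciprocalExponent_left hz) hf hfs hg hgs)
    (fun z hz => (hK₁ z hz).norm_integral_phasePower_le hp_pos hq_pos hp₁ hq₁
      (re_reciprocalExponent_right hab hz) (re_reciprocalExponent_right hab hz) hf hfs hg hgs)
  have hθ_mem : θ ∈ Set.Icc 0 1 := hθ ▸ div_sub_mem_Icc hab hw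
  rw [← hθ, rpow_interpolation_mul hA₀ hA₁ (by positivity) (by positivity) hθ_mem (by positivity)
    (by positivity) (by positivity) (by positivity), ← hp, ← hq] at h
  simpa only [l, m, hlw, hmw, mul_inv_cancel₀ hp_ne, mul_inv_cancel₀ hq_ne, phasePower_one] using h

end Stein

section Duality

/-- The function `conj v · |v| ^ (q - 2)`, for which Hölder's inequality with `v` in `L^q` is an
equality. -/
def dualFunction {α : Type*} (q : ℝ) (v : α → ℂ) : α → ℂ :=
  phasePower (q - 1 : ℝ) fun x => (starRingEnd ℂ) (v x)

variable {α : Type*} {p q : ℝ} {v : α → ℂ}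

lemma norm_dualFunction_rpow (hpq : p.HolderConjugate q) (v : α → ℂ) (x : α) :
    ‖dualFunction q v x‖ ^ p = ‖v x‖ ^ q := by
  rw [dualFunction, norm_phasePower_rpow (sub_pos.2 hpq.symm.lt) hpq.symm.sub_one_mul_conj,
    RCLike.norm_conj]

lemma dualFunction_mul_self (hq : 1 < q) (v : α → ℂ) (x : α) :
    dualFunction q v x * v x = ((‖v x‖ ^ q : ℝ) : ℂ) := by
  rw [dualFunction, phasePower, RCLike.norm_conj, mul_right_comm, Complex.conj_mul',
    ← Complex.ofReal_one, ← Complex.ofReal_sub, ← Complex.ofReal_cpow (norm_nonneg _),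
    ← Complex.ofReal_pow, ← Complex.ofReal_mul]
  rcases (norm_nonneg (v x)).eq_or_lt with h | h
  · rw [← h, zero_pow two_ne_zero, zero_mul, Real.zero_rpow (zero_lt_one.trans hq).ne']
  · rw [← Real.rpow_natCast, ← Real.rpow_add h, Nat.cast_ofNat, show 2 + (q - 1 - 1) = q by ring]

lemma rpow_inv_le_of_le_mul_rpow_inv (hpq : p.HolderConjugate q) {A N : ℝ} (hA : 0 ≤ A)
    (hN : 0 ≤ N) (h : N ≤ A * N ^ p⁻¹) : N ^ q⁻¹ ≤ A := by
  rcases hN.eq_or_lt with h0 | h0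
  · rwa [← h0, Real.zero_rpow (inv_ne_zero hpq.symm.pos.ne')]
  · refine le_of_mul_le_mul_right ?_ (Real.rpow_pos_of_pos h0 p⁻¹)
    rwa [← Real.rpow_add h0, add_comm, hpq.inv_add_inv_eq_one, Real.rpow_one]

variable [MeasurableSpace α] {μ : Measure α}

lemma eLpNorm_le_of_norm_integral_dualFunction_mul_le (hpq : p.HolderConjugate q) {A : ℝ}
    (hA : 0 ≤ A) (hv : MemLp v (ENNReal.ofReal q) μ)
    (h : ‖∫ x, dualFunction q v x * v x ∂μ‖ ≤ A * (∫ x, ‖dualFunction q v x‖ ^ p ∂μ) ^ p⁻¹) :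
    eLpNorm v (ENNReal.ofReal q) μ ≤ ENNReal.ofReal A := by
  simp only [dualFunction_mul_self hpq.symm.lt, norm_dualFunction_rpow hpq,
    integral_complex_ofReal, Complex.norm_real] at h
  rw [← ofReal_rpow_integral_norm_rpow hpq.symm.pos hv]
  exact ENNReal.ofReal_le_ofReal
    (rpow_inv_le_of_le_mul_rpow_inv hpq hA (by positivity) ((Real.le_norm_self _).trans h))

lemma eLpNorm_le_of_forall_eLpNorm_restrict_le {E : Type*} [NormedAddCommGroup E] {v : α → E}
    {r A : ℝ≥0∞} (hr : r ≠ 0) (hr' : r ≠ ∞) {s : ℕ → Set α} (hs : Monotone s)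
    (hs' : ⋃ i, s i = Set.univ) (h : ∀ i, eLpNorm v r (μ.restrict (s i)) ≤ A) :
    eLpNorm v r μ ≤ A := by
  have hr_pos : 0 < r.toReal := ENNReal.toReal_pos hr hr'
  simp only [eLpNorm_eq_lintegral_rpow_enorm_toReal hr hr', one_div,
    ENNReal.rpow_inv_le_iff hr_pos] at h ⊢
  rw [← setLIntegral_univ, ← hs', setLIntegral_iUnion_of_directed _ hs.directed_le]
  exact iSup_le h

lemma eLpNorm_le_of_forall_norm_integral_mul_le [TopologicalSpace α] [T2Space α]
    [SigmaCompactSpace α] [BorelSpace α] [IsFiniteMeasureOnCompacts μ]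
    (hpq : p.HolderConjugate q) (hv : Continuous v) {A : ℝ} (hA : 0 ≤ A)
    (h : ∀ g : α → ℂ, MemLp g (ENNReal.ofReal p) μ → HasCompactSupport g →
      ‖∫ x, g x * v x ∂μ‖ ≤ A * (∫ x, ‖g x‖ ^ p ∂μ) ^ p⁻¹) :
    eLpNorm v (ENNReal.ofReal q) μ ≤ ENNReal.ofReal A := by
  refine eLpNorm_le_of_forall_eLpNorm_restrict_le (ENNReal.ofReal_pos.2 hpq.symm.pos).ne'
    ENNReal.ofReal_ne_top (compactCovering_subset α) (iUnion_compactCovering α) fun i => ?_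
  have hK : IsCompact (compactCovering α i) := isCompact_compactCovering α i
  have hKm : MeasurableSet (compactCovering α i) := hK.measurableSet
  have hvK : MemLp v (ENNReal.ofReal q) (μ.restrict (compactCovering α i)) := by
    rw [← integrable_norm_rpow_iff hv.aestronglyMeasurable
      (ENNReal.ofReal_pos.2 hpq.symm.pos).ne' ENNReal.ofReal_ne_top,
      ENNReal.toReal_ofReal hpq.symm.nonneg]
    exact (hv.norm.rpow_const fun _ => Or.inr hpq.symm.nonneg).continuousOn.integrableOn_compact hK
  have hg : MemLp ((compactCovering α i).indicator (dualFunction q v)) (ENNReal.ofReal p) μ :=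
    (memLp_indicator_iff_restrict hKm).2 (memLp_phasePower hpq.symm.pos
      (sub_pos.2 hpq.symm.lt) hpq.symm.sub_one_mul_conj hvK.star)
  have h_mul : ∀ x, (compactCovering α i).indicator (dualFunction q v) x * v x =
      (compactCovering α i).indicator (fun x => dualFunction q v x * v x) x := fun x =>
    (Set.indicator_mul_left _ _ _).symm
  have h_rpow : ∀ x, ‖(compactCovering α i).indicator (dualFunction q v) x‖ ^ p =
      (compactCovering α i).indicator (fun x => ‖dualFunction q v x‖ ^ p) x := fun x =>
    (congrFun (Set.indicator_comp_of_zero (g := fun c : ℂ => ‖c‖ ^ p)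
      (by rw [norm_zero, Real.zero_rpow hpq.pos.ne'])) x).symm
  have key := h _ hg (HasCompactSupport.intro hK fun x hx => Set.indicator_of_notMem hx _)
  simp only [h_mul, h_rpow, integral_indicator hKm] at key
  exact eLpNorm_le_of_norm_integral_dualFunction_mul_le hpq hA hvK key

end Duality

section CompactSupport

variable {X E : Type*} [TopologicalSpace X] [MeasurableSpace X] {μ : Measure X}
  [IsFiniteMeasureOnCompacts μ] [NormedAddCommGroup E] {f : X → E}

lemma measure_support_ne_top_of_hasCompactSupport (hfs : HasCompactSupport f) :
    μ (Function.support f) ≠ ∞ :=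
  measure_ne_top_of_subset (subset_tsupport f) hfs.measure_lt_top.ne

lemma integrable_of_memLp_of_hasCompactSupport {p : ℝ≥0∞} (hp : 1 ≤ p) (hf : MemLp f p μ)
    (hfs : HasCompactSupport f) : Integrable f μ := by
  have : IsFiniteMeasure (μ.restrict (tsupport f)) :=
    isFiniteMeasure_restrict.2 hfs.measure_lt_top.ne
  exact (integrableOn_iff_integrable_of_support_subset (subset_tsupport f)).1
    ((hf.restrict (tsupport f)).integrable hp)

end CompactSupport

section LpEstimate

lemma kernelFormBound_one_of_norm_le {α β : Type*} [MeasurableSpace α] [MeasurableSpace β]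
    {μ : Measure α} {ν : Measure β} [SFinite μ] [SFinite ν] {k : α × β → ℂ} {C : ℝ}
    (hk : ∀ x, ‖k x‖ ≤ C) : KernelFormBound k 1 1 μ ν C := by
  intro f g hf _ hg _
  simp only [Real.rpow_one, inv_one]
  rw [← integral_prod_mul, ← integral_const_mul]
  refine norm_integral_le_of_norm_le ((hf.norm.mul_prod hg.norm).const_mul C)
    (Eventually.of_forall fun x => ?_)
  rw [norm_mul, norm_mul]
  exact mul_le_mul_of_nonneg_right (hk x) (by positivity)

variable {V : Type*} [NormedAddCommGroup V] [InnerProductSpace ℝ V]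

/-- The kernel of `S̃ ^ z`, as a function of two variables, with the weight that makes it bounded
on the strip of interpolation. -/
def weightedKernel (z : ℂ) (x : V × V) : ℂ :=
  interpolationWeight (finrank ℝ V) z * bochnerRieszKernel z (x.1 - x.2)

lemma continuous_weightedKernel (z : ℂ) : Continuous (weightedKernel (V := V) z) :=
  (continuous_bochnerRieszKernel.comp
    (show Continuous fun x : V × V => (z, x.1 - x.2) by fun_prop)).const_mul _

lemma diffContOnCl_weightedKernel (x : V × V) :
    DiffContOnCl ℂ (fun z => weightedKernel z x)
      (Complex.re ⁻¹' Set.Ioo (-(((finrank ℝ V : ℝ) + 1) / 2)) 0) := by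
  refine DifferentiableOn.diffContOnCl fun z hz => ?_
  rw [closure_re_preimage_Ioo (neg_lt_zero.2 (by positivity))] at hz
  exact ((differentiableAt_interpolationWeight hz.1).mul
    (differentiable_bochnerRieszKernel _ z)).differentiableWithinAt

lemma exists_norm_weightedKernel_le (V : Type*) [NormedAddCommGroup V] [InnerProductSpace ℝ V]
    [FiniteDimensional ℝ V] [Nontrivial V] :
    ∃ C : ℝ, 1 ≤ C ∧ ∀ z : ℂ, -(((finrank ℝ V : ℝ) + 1) / 2) ≤ z.re → ∀ x : V × V,
      ‖weightedKernel z x‖ ≤ C := by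
  obtain ⟨C, -, hC⟩ := exists_norm_interpolationWeight_mul_bochnerRieszKernel_le V
  exact ⟨max C 1, le_max_right _ _, fun z hz x => (hC z hz _).trans (le_max_left _ _)⟩

variable [FiniteDimensional ℝ V] [MeasurableSpace V] [BorelSpace V] {z : ℂ} {f g : V → ℂ}

lemma integral_weightedKernel_eq (x : V) : ∫ y, f y * weightedKernel z (x, y) =
    interpolationWeight (finrank ℝ V) z * analyticBochnerRiesz z f x := by
  rw [analyticBochnerRiesz, ← integral_const_mul]
  exact integral_congr_ae (Eventually.of_forall fun y => mul_left_comm _ _ _)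

lemma eLpNorm_top_analyticBochnerRiesz_le {C : ℝ}
    (hz : -(((finrank ℝ V : ℝ) + 1) / 2) ≤ z.re) (hC : ∀ x : V × V, ‖weightedKernel z x‖ ≤ C)
    (hf : Integrable f) :
    eLpNorm (analyticBochnerRiesz z f) ∞ ≤
      ENNReal.ofReal (C / ‖interpolationWeight (finrank ℝ V) z‖) * eLpNorm f 1 := by
  have hweight := norm_pos_iff.2 (interpolationWeight_ne_zero hz)
  have hC0 : 0 ≤ C := (norm_nonneg _).trans (hC 0)
  rw [eLpNorm_one_eq_lintegral_enorm, ← ofReal_integral_norm_eq_lintegral_enorm hf,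
    ← ENNReal.ofReal_mul (by positivity), eLpNorm_exponent_top]
  refine eLpNormEssSup_le_of_ae_bound (Eventually.of_forall fun x => ?_)
  rw [div_mul_eq_mul_div, le_div_iff₀' hweight, ← norm_mul, ← integral_weightedKernel_eq,
    ← integral_const_mul]
  exact norm_integral_le_of_norm_le (hf.norm.const_mul C) (Eventually.of_forall fun y => by
    rw [norm_mul, mul_comm]
    exact mul_le_mul_of_nonneg_right (hC _) (norm_nonneg _))

variable [Nontrivial V]

lemma continuous_analyticBochnerRiesz (hz : -(((finrank ℝ V : ℝ) + 1) / 2) ≤ z.re)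
    (hf : Integrable f) : Continuous (analyticBochnerRiesz z f) := by
  obtain ⟨C, -, hC⟩ := exists_norm_weightedKernel_le V
  have h : Continuous fun x => ∫ y, f y * weightedKernel z (x, y) := by
    refine continuous_of_dominated (bound := fun y => ‖f y‖ * C) (fun x => ?_) (fun x => ?_)
      (hf.norm.mul_const C) (Eventually.of_forall fun y => ?_)
    · exact hf.1.mul ((continuous_weightedKernel z).comp
        (show Continuous fun y : V => (x, y) by fun_prop)).aestronglyMeasurable
    · exact Eventually.of_forall fun y => (norm_mul_le _ _).trans
        (mul_le_mul_of_nonneg_left (hC z hz _) (norm_nonneg _))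
    · exact continuous_const.mul ((continuous_weightedKernel z).comp
        (show Continuous fun x : V => (x, y) by fun_prop))
  simp only [integral_weightedKernel_eq] at h
  exact (continuous_const_smul_iff₀ (interpolationWeight_ne_zero hz)).1 h

lemma integral_weightedKernel_mul_eq (hz : -(((finrank ℝ V : ℝ) + 1) / 2) ≤ z.re)
    (hg : Integrable g) (hf : Integrable f) :
    ∫ x : V × V, weightedKernel z x * (g x.1 * f x.2) =
      interpolationWeight (finrank ℝ V) z * ∫ x, g x * analyticBochnerRiesz z f x := by
  obtain ⟨C, -, hC⟩ := exists_norm_weightedKernel_le V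
  have hint : Integrable fun x : V × V => weightedKernel z x * (g x.1 * f x.2) :=
    (hg.mul_prod hf).bdd_mul (continuous_weightedKernel z).aestronglyMeasurable
      (Eventually.of_forall (hC z hz))
  rw [Measure.volume_eq_prod, integral_prod _ hint, ← integral_const_mul]
  refine integral_congr_ae (Eventually.of_forall fun x => ?_)
  simp only [mul_left_comm (interpolationWeight _ z), ← integral_weightedKernel_eq]
  rw [← integral_const_mul]
  exact integral_congr_ae (Eventually.of_forall fun y => by dsimp only; ring)

lemma kernelFormBound_two_weightedKernel (hz : z.re = 0) :
    KernelFormBound (weightedKernel (V := V) z) 2 2 volume volume 1 := by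
  have hz' : -(((finrank ℝ V : ℝ) + 1) / 2) ≤ z.re := hz ▸ neg_nonpos.2 (by positivity)
  intro g f hg hg2 hf hf2
  rw [ENNReal.ofReal_ofNat] at hg2 hf2
  rw [← Measure.volume_eq_prod, integral_weightedKernel_mul_eq hz' hg hf, one_mul, norm_mul,
    ← one_div, mul_comm (_ ^ _)]
  refine (mul_le_mul_of_nonneg_right (norm_interpolationWeight_le _ hz.ge)
    (norm_nonneg _)).trans ?_
  rw [← norm_mul]
  exact norm_integral_mul_integral_bochnerRieszKernel_le hz hf hf2 hg hg2

lemma norm_integral_mul_analyticBochnerRiesz_le {C : ℝ} (hC1 : 1 ≤ C)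
    (hC : ∀ z : ℂ, -(((finrank ℝ V : ℝ) + 1) / 2) ≤ z.re → ∀ x : V × V, ‖weightedKernel z x‖ ≤ C)
    {w : ℂ} (hw : w.re ∈ Set.Icc (-(((finrank ℝ V : ℝ) + 1) / 2)) 0) {p : ℝ} (hp1 : 1 ≤ p)
    (hp : p⁻¹ = 1 / 2 - w.re / (finrank ℝ V + 1)) (hg : MemLp g (ENNReal.ofReal p))
    (hgs : HasCompactSupport g) (hf : MemLp f (ENNReal.ofReal p)) (hfs : HasCompactSupport f) :
    ‖interpolationWeight (finrank ℝ V) w * ∫ x, g x * analyticBochnerRiesz w f x‖ ≤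
      C * ((∫ x, ‖g x‖ ^ p) ^ p⁻¹ * (∫ x, ‖f x‖ ^ p) ^ p⁻¹) := by
  have hp1' : 1 ≤ ENNReal.ofReal p := ENNReal.one_le_ofReal.2 hp1
  have ha : -(((finrank ℝ V : ℝ) + 1) / 2) < 0 := neg_lt_zero.2 (by positivity)
  let θ : ℝ := (w.re - -(((finrank ℝ V : ℝ) + 1) / 2)) / (0 - -(((finrank ℝ V : ℝ) + 1) / 2))
  have hθ : 0 ≤ θ := (div_sub_mem_Icc ha hw).1
  have hpθ : p⁻¹ = (1 - θ) * 1⁻¹ + θ * 2⁻¹ := by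
    rw [hp]
    simp only [θ]
    field_simp
    ring
  have h := norm_integral_le_of_stein_interpolation (μ := volume) (ν := volume) ha
    le_rfl le_rfl one_le_two one_le_two (zero_le_one.trans hC1) zero_le_one hw (θ := θ) rfl hpθ hpθ
    (fun z _ => (continuous_weightedKernel (V := V) z).aestronglyMeasurable)
    diffContOnCl_weightedKernel (fun z hz => hC z hz.1)
    (fun z hz => kernelFormBound_one_of_norm_le (hC z hz.ge))
    (fun z hz => kernelFormBound_two_weightedKernel hz)
    hg (measure_support_ne_top_of_hasCompactSupport hgs)
    hf (measure_support_ne_top_of_hasCompactSupport hfs)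
  rw [← Measure.volume_eq_prod, integral_weightedKernel_mul_eq hw.1
    (integrable_of_memLp_of_hasCompactSupport hp1' hg hgs)
    (integrable_of_memLp_of_hasCompactSupport hp1' hf hfs), Real.one_rpow, mul_one] at h
  refine h.trans (mul_le_mul_of_nonneg_right ?_ (by positivity))
  exact Real.rpow_le_self_of_one_le hC1 (sub_le_self 1 hθ)

lemma eLpNorm_analyticBochnerRiesz_le_of_holderConjugate {C : ℝ} (hC1 : 1 ≤ C)
    (hC : ∀ z : ℂ, -(((finrank ℝ V : ℝ) + 1) / 2) ≤ z.re → ∀ x : V × V, ‖weightedKernel z x‖ ≤ C)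
    {w : ℂ} (hw : w.re ∈ Set.Icc (-(((finrank ℝ V : ℝ) + 1) / 2)) 0) {p q : ℝ}
    (hpq : p.HolderConjugate q) (hp : p⁻¹ = 1 / 2 - w.re / (finrank ℝ V + 1))
    (hf : MemLp f (ENNReal.ofReal p)) (hfs : HasCompactSupport f) :
    eLpNorm (analyticBochnerRiesz w f) (ENNReal.ofReal q) ≤
      ENNReal.ofReal (C / ‖interpolationWeight (finrank ℝ V) w‖) *
        eLpNorm f (ENNReal.ofReal p) := by
  have hweight := norm_pos_iff.2 (interpolationWeight_ne_zero hw.1)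
  rw [← ofReal_rpow_integral_norm_rpow hpq.pos hf, ← ENNReal.ofReal_mul (by positivity)]
  refine eLpNorm_le_of_forall_norm_integral_mul_le hpq (continuous_analyticBochnerRiesz hw.1
    (integrable_of_memLp_of_hasCompactSupport (ENNReal.one_le_ofReal.2 hpq.lt.le) hf hfs))
    (by positivity) fun g hg hgs => ?_
  have h := norm_integral_mul_analyticBochnerRiesz_le hC1 hC hw hpq.lt.le hp hg hgs hf hfs
  rw [norm_mul] at h
  rwa [div_mul_eq_mul_div, div_mul_eq_mul_div, le_div_iff₀' hweight, mul_assoc, mul_comm (_ ^ _)]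

theorem exists_eLpNorm_analyticBochnerRiesz_le (V : Type*) [NormedAddCommGroup V]
    [InnerProductSpace ℝ V] [FiniteDimensional ℝ V] [MeasurableSpace V] [BorelSpace V]
    [Nontrivial V] :
    ∃ C : ℝ, 0 ≤ C ∧ ∀ w : ℂ, w.re ∈ Set.Icc (-(((finrank ℝ V : ℝ) + 1) / 2)) 0 →
      ∀ p q : ℝ≥0∞, p⁻¹ = ENNReal.ofReal (1 / 2 - w.re / (finrank ℝ V + 1)) →
        q⁻¹ = ENNReal.ofReal (1 / 2 + w.re / (finrank ℝ V + 1)) →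
        ∀ f : V → ℂ, MemLp f p → HasCompactSupport f →
          eLpNorm (analyticBochnerRiesz w f) q ≤
            ENNReal.ofReal (C / ‖interpolationWeight (finrank ℝ V) w‖) * eLpNorm f p := by
  obtain ⟨C, hC1, hC⟩ := exists_norm_weightedKernel_le V
  refine ⟨C, zero_le_one.trans hC1, fun w hw p q hp hq f hf hfs => ?_⟩
  have hp_pos : 0 < 1 / 2 - w.re / (finrank ℝ V + 1) :=
    sub_pos.2 ((div_nonpos_of_nonpos_of_nonneg hw.2 (by positivity)).trans_lt one_half_pos)
  have hq_nonneg : 0 ≤ 1 / 2 + w.re / (finrank ℝ V + 1) := by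
    have h : -(1 / 2) ≤ w.re / (finrank ℝ V + 1) := by
      rw [le_div_iff₀ (by positivity)]
      linarith [hw.1]
    linarith
  rw [← inv_inv p, hp, ← ENNReal.ofReal_inv_of_pos hp_pos] at hf ⊢
  rw [← inv_inv q, hq]
  rcases hq_nonneg.eq_or_lt with h | h
  · have hp_eq : 1 / 2 - w.re / (finrank ℝ V + 1) = 1 := by linarith
    rw [hp_eq, inv_one, ENNReal.ofReal_one] at hf ⊢
    rw [← h, ENNReal.ofReal_zero, ENNReal.inv_zero]
    exact eLpNorm_top_analyticBochnerRiesz_le hw.1 (hC w hw.1) (memLp_one_iff_integrable.1 hf)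
  · rw [← ENNReal.ofReal_inv_of_pos h]
    have hpq : (1 / 2 - w.re / (finrank ℝ V + 1))⁻¹.HolderConjugate
        (1 / 2 + w.re / (finrank ℝ V + 1))⁻¹ := by
      refine Real.holderConjugate_iff.2 ⟨(one_lt_inv₀ hp_pos).2 (by linarith), ?_⟩
      rw [inv_inv, inv_inv]
      ring
    exact eLpNorm_analyticBochnerRiesz_le_of_holderConjugate hC1 hC hw hpq (inv_inv _) hf hfs

end LpEstimate

section Extension

variable {X Y 𝕜 E F : Type*} [TopologicalSpace X] [MeasurableSpace X] [MeasurableSpace Y]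
  [NormedField 𝕜] [NormedAddCommGroup E] [NormedSpace 𝕜 E] [NormedAddCommGroup F]
  [NormedSpace 𝕜 F] {μ : Measure X} {ν : Measure Y} {p q : ℝ≥0∞}

variable (𝕜 E μ p) in
/-- The space of functions of compact support in `L^p`, on which an operator is given before it is
extended to all of `L^p`. Its elements are functions, not classes modulo null sets, as the compact
support refers to the function itself. -/
def compactlySupportedMemLp : Submodule 𝕜 (X → E) where
  carrier := {f | MemLp f p μ ∧ HasCompactSupport f}
  add_mem' hf hg := ⟨hf.1.add hg.1, hf.2.add hg.2⟩
  zero_mem' := ⟨MemLp.zero, HasCompactSupport.zero⟩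
  smul_mem' c _ hf := ⟨hf.1.const_smul c, hf.2.smul_left (f := fun _ => c)⟩

variable (𝕜 E μ p) in
/-- The map of the functions of compact support in `L^p` to their classes in `L^p`. -/
def compactlySupportedToLp : compactlySupportedMemLp 𝕜 E μ p →ₗ[𝕜] Lp E p μ where
  toFun f := f.2.1.toLp f.1
  map_add' f g := MemLp.toLp_add f.2.1 g.2.1
  map_smul' c f := MemLp.toLp_const_smul c f.2.1

variable [NormalSpace X] [R1Space X] [WeaklyLocallyCompactSpace X] [BorelSpace X] [μ.Regular]
  [NormedSpace ℝ E] [Fact (1 ≤ p)]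

lemma denseRange_compactlySupportedToLp (hp : p ≠ ∞) :
    DenseRange (compactlySupportedToLp 𝕜 E μ p) := by
  intro f
  refine EMetric.mem_closure_iff.2 fun ε hε => ?_
  obtain ⟨δ, hδ, hδε⟩ := exists_between hε
  obtain ⟨g, hgs, hfg, -, hg⟩ :=
    (Lp.memLp f).exists_hasCompactSupport_eLpNorm_sub_le hp hδ.ne'
  refine ⟨_, ⟨⟨g, hg, hgs⟩, rfl⟩, lt_of_le_of_lt ?_ hδε⟩
  rw [Lp.edist_def]
  exact (eLpNorm_congr_ae (EventuallyEq.rfl.sub hg.coeFn_toLp)).trans_le hfg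

lemma exists_continuousLinearMap_extending_of_eLpNorm_le [Fact (1 ≤ q)] [CompleteSpace F]
    (hp : p ≠ ∞) (A : compactlySupportedMemLp 𝕜 E μ p →ₗ[𝕜] Y → F)
    (hA : ∀ f, AEStronglyMeasurable (A f) ν) {M : ℝ} (hM : 0 ≤ M)
    (hAM : ∀ f, eLpNorm (A f) q ν ≤ ENNReal.ofReal M * eLpNorm f.1 p μ) :
    ∃ T : Lp E p μ →L[𝕜] Lp F q ν,
      (∀ f, T (compactlySupportedToLp 𝕜 E μ p f) =ᵐ[ν] A f) ∧ ∀ f, ‖T f‖ ≤ M * ‖f‖ := by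
  have hmem (f) : MemLp (A f) q ν :=
    ⟨hA f, (hAM f).trans_lt (ENNReal.mul_lt_top ENNReal.ofReal_lt_top f.2.1.2)⟩
  let S : compactlySupportedMemLp 𝕜 E μ p →ₗ[𝕜] Lp F q ν :=
    { toFun f := (hmem f).toLp (A f)
      map_add' f g := by simp only [map_add, MemLp.toLp_add (hmem f) (hmem g)]
      map_smul' c f := by
        simp only [map_smul, MemLp.toLp_const_smul c (hmem f), RingHom.id_apply] }
  have hS (f) : ‖S f‖ ≤ M * ‖compactlySupportedToLp 𝕜 E μ p f‖ := by
    refine (Lp.norm_toLp _ (hmem f)).trans_le ?_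
    rw [show ‖compactlySupportedToLp 𝕜 E μ p f‖ = _ from Lp.norm_toLp _ f.2.1,
      ← ENNReal.toReal_ofReal hM, ← ENNReal.toReal_mul]
    exact ENNReal.toReal_mono (ENNReal.mul_ne_top ENNReal.ofReal_ne_top f.2.1.2.ne) (hAM f)
  have hdense : DenseRange (compactlySupportedToLp 𝕜 E μ p) :=
    denseRange_compactlySupportedToLp hp
  refine ⟨S.extendOfNorm (compactlySupportedToLp 𝕜 E μ p), fun f => ?_,
    LinearMap.norm_extendOfNorm_apply_le hdense M hS⟩
  rw [LinearMap.extendOfNorm_eq hdense ⟨M, hS⟩]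
  exact (hmem f).coeFn_toLp

end Extension

section Exponents

variable {n : ℕ} {β : ℝ}

lemma inv_sourceExponent (hβ : 0 ≤ β) :
    (sourceExponent n β)⁻¹ = ENNReal.ofReal (1 / 2 - -2 * β / (n + 1)) := by
  rw [sourceExponent, ENNReal.inv_div (.inl ENNReal.ofReal_ne_top)
    (.inl (ENNReal.ofReal_pos.2 (by positivity)).ne'), ← ENNReal.ofReal_div_of_pos (by positivity)]
  congr 1
  field_simp
  ring

lemma inv_targetExponent :
    (targetExponent n β)⁻¹ = ENNReal.ofReal (1 / 2 + -2 * β / (n + 1)) := by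
  have hn : (0 : ℝ) < 2 * n + 2 := by positivity
  rw [targetExponent, ENNReal.inv_div (.inl ENNReal.ofReal_ne_top)
    (.inr (ENNReal.ofReal_pos.2 hn).ne'), ← ENNReal.ofReal_div_of_pos hn]
  congr 1
  field_simp
  ring

lemma one_le_sourceExponent (hβ₀ : 0 ≤ β) (hβ : β ≤ ((n : ℝ) + 1) / 4) :
    1 ≤ sourceExponent n β := by
  rw [← ENNReal.inv_le_one, inv_sourceExponent hβ₀, ENNReal.ofReal_le_one, sub_le_iff_le_add,
    ← sub_le_iff_le_add', le_div_iff₀ (by positivity)]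
  linarith

lemma sourceExponent_ne_top (hβ : 0 ≤ β) : sourceExponent n β ≠ ∞ :=
  ENNReal.div_ne_top ENNReal.ofReal_ne_top (ENNReal.ofReal_pos.2 (by positivity)).ne'

lemma one_le_targetExponent (hβ : 0 ≤ β) : 1 ≤ targetExponent n β := by
  rw [← ENNReal.inv_le_one, inv_targetExponent, ENNReal.ofReal_le_one, ← le_sub_iff_add_le',
    div_le_iff₀ (by positivity)]
  nlinarith [(Nat.cast_nonneg n : (0 : ℝ) ≤ n)]

end Exponents

/-- The operator `S̃ ^ z` as a linear map on the functions of compact support in `L^p`. -/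
def analyticBochnerRieszLinearMap (V : Type*) [NormedAddCommGroup V] [InnerProductSpace ℝ V]
    [FiniteDimensional ℝ V] [MeasurableSpace V] [BorelSpace V] {p : ℝ≥0∞} (hp : 1 ≤ p) (z : ℂ) :
    compactlySupportedMemLp ℂ ℂ (volume : Measure V) p →ₗ[ℂ] V → ℂ where
  toFun f := analyticBochnerRiesz z f.1
  map_add' f g := analyticBochnerRiesz_add (integrable_of_memLp_of_hasCompactSupport hp f.2.1 f.2.2)
    f.2.2 (integrable_of_memLp_of_hasCompactSupport hp g.2.1 g.2.2) g.2.2 z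
  map_smul' c f := analyticBochnerRiesz_smul c f.1 z

lemma exists_linearMap_extendsAnalyticBochnerRiesz {n : ℕ} (hn : 1 ≤ n) :
    ∃ C : ℝ, ∀ β : ℝ, 0 ≤ β → β ≤ ((n : ℝ) + 1) / 4 → ∀ w : ℂ, w.re = -2 * β →
      ∃ T : Lp ℂ (sourceExponent n β) (volume : Measure (EuclideanSpace ℝ (Fin n))) →ₗ[ℂ]
          Lp ℂ (targetExponent n β) (volume : Measure (EuclideanSpace ℝ (Fin n))),
        ExtendsAnalyticBochnerRiesz w T ∧ ∀ f, ‖T f‖ ≤ C / ‖interpolationWeight n w‖ * ‖f‖ := by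
  have : NeZero n := ⟨Nat.one_le_iff_ne_zero.1 hn⟩
  obtain ⟨C, hC0, hC⟩ := exists_eLpNorm_analyticBochnerRiesz_le (EuclideanSpace ℝ (Fin n))
  simp only [finrank_euclideanSpace_fin] at hC
  refine ⟨C, fun β hβ₀ hβ w hw => ?_⟩
  have hw_mem : w.re ∈ Set.Icc (-(((n : ℝ) + 1) / 2)) 0 := ⟨by linarith, by linarith⟩
  have hp : 1 ≤ sourceExponent n β := one_le_sourceExponent hβ₀ hβ
  have : Fact (1 ≤ sourceExponent n β) := ⟨hp⟩
  have : Fact (1 ≤ targetExponent n β) := ⟨one_le_targetExponent hβ₀⟩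
  have hint (f : EuclideanSpace ℝ (Fin n) → ℂ) (hf : MemLp f (sourceExponent n β))
      (hfs : HasCompactSupport f) : Integrable f :=
    integrable_of_memLp_of_hasCompactSupport hp hf hfs
  obtain ⟨T, hT, hTC⟩ := exists_continuousLinearMap_extending_of_eLpNorm_le
    (sourceExponent_ne_top hβ₀) (analyticBochnerRieszLinearMap _ hp w)
    (fun f => (continuous_analyticBochnerRiesz (by simpa using hw_mem.1)
      (hint f.1 f.2.1 f.2.2)).aestronglyMeasurable) (by positivity)
    (fun f => hC w hw_mem _ _ (hw ▸ inv_sourceExponent hβ₀) (hw ▸ inv_targetExponent)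
      f.1 f.2.1 f.2.2)
  exact ⟨T, fun f hf hfs => ⟨analyticBochnerRiesz w f,
    isAnalyticBochnerRiesz_analyticBochnerRiesz hn (hint f hf hfs) hfs w, hT ⟨f, hf, hfs⟩⟩, hTC⟩

theorem mainTheorem5_general (n : ℕ) (hn : 1 ≤ n) (β : ℝ) (hβ₀ : 0 ≤ β)
    (hβ : β ≤ ((n : ℝ) + 1) / 4) (hpole : ∀ k : ℕ, k ≠ 0 → k ≠ 2 → 2 * β ≠ k) :
    ∃ C : ℝ, ∀ μ : ℝ,
      ∃ T : Lp ℂ (sourceExponent n β) (volume : Measure (EuclideanSpace ℝ (Fin n))) →ₗ[ℂ]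
          Lp ℂ (targetExponent n β) (volume : Measure (EuclideanSpace ℝ (Fin n))),
        ExtendsAnalyticBochnerRiesz (-2 * (β : ℂ) + μ * I) T ∧
        ∀ f, ‖bochnerRieszFactor (-2 * (β : ℂ) + μ * I) • T f‖ ≤ C * (1 + |μ|) * ‖f‖ := by
  have hre : -(((n : ℝ) + 1) / 2) ≤ -2 * β := by linarith
  obtain ⟨M, hM⟩ := exists_linearMap_extendsAnalyticBochnerRiesz hn
  obtain ⟨C, hC0, hC⟩ := exists_norm_bochnerRieszFactor_le hn hre fun k h0 h2 h =>
    hpole k h0 h2 (by linarith)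
  refine ⟨C * M, fun μ => ?_⟩
  set w : ℂ := -2 * (β : ℂ) + μ * I with hw
  have hw_re : w.re = -2 * β := by simp [hw]
  have hw_im : w.im = μ := by simp [hw]
  have hweight := norm_pos_iff.2 (interpolationWeight_ne_zero (n := n) (hre.trans_eq hw_re.symm))
  obtain ⟨T, hT, hTM⟩ := hM β hβ₀ hβ w hw_re
  refine ⟨T, hT, fun f => ?_⟩
  have : Fact (1 ≤ targetExponent n β) := ⟨one_le_targetExponent hβ₀⟩
  calc ‖bochnerRieszFactor w • T f‖ = ‖bochnerRieszFactor w‖ * ‖T f‖ := norm_smul _ _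
    _ ≤ C * (1 + |w.im|) * ‖interpolationWeight n w‖ *
        (M / ‖interpolationWeight n w‖ * ‖f‖) := by gcongr; exacts [hC w hw_re, hTM f]
    _ = C * M * (1 + |μ|) * ‖f‖ := by rw [hw_im]; field_simp

end

theorem mainTheorem5 (n : ℕ) (β : ℝ) (hβ₁ : 1 / 2 < β) (hβ₂ : β < 3 / 2)
    (hβ₃ : β ≤ ((n : ℝ) + 1) / 4) :
    ∃ C : ℝ, ∀ μ : ℝ,
      ∃ T : Lp ℂ (sourceExponent n β) (volume : Measure (EuclideanSpace ℝ (Fin n))) →ₗ[ℂ]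
          Lp ℂ (targetExponent n β) (volume : Measure (EuclideanSpace ℝ (Fin n))),
        ExtendsAnalyticBochnerRiesz (-2 * (β : ℂ) + μ * Complex.I) T ∧
        ∀ f, ‖bochnerRieszFactor (-2 * (β : ℂ) + μ * Complex.I) • T f‖ ≤
          C * (1 + |μ|) * ‖f‖ := by
  have hn : (1 : ℝ) ≤ n := by linarith
  refine mainTheorem5_general n (mod_cast hn) β (by linarith) hβ₃ fun k _ h2 h => h2 ?_
  have hk₁ : (1 : ℝ) < k := by linarith
  have hk₃ : (k : ℝ) < 3 := by linarith
  norm_cast at hk₁ hk₃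
  omega
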